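/- Let $0<\alpha<2$, let $E\subset\mathbb R^m$ be a Borel set with $0<|E|<\infty$, and put $C_\alpha=\left(\int_0^\infty x^{-\alpha}\sin x\,dx\right)^{-1}$ (improper integral). Let $\Gamma_1<\Gamma_2<\cdots$ be the arrival times of a Poisson process of rate $1$, that is, $\Gamma_k=\lambda_1+\dots+\lambda_k$ with $\lambda_j$ independent and standard exponential. Independently of these, let $(V_k,\rho_k)_{k\ge1}$ be an i.i.d. sequence in which $V_k$ is uniformly distributed on $E$ and $\rho_k$ is independent of $V_k$ with $P(\rho_k=1)=P(\rho_k=-1)=\tfrac12$. For $s\ge 0$ and $1<p<\infty$ let $H^s_p=H^s_p(\mathbb R^d)$ be the space of complex tempered distributions $u$ on $\mathbb R^d$ with $\mathcal F^{-1}\left((1+|\xi|^2)^{s/2}\mathcal F u\right)\in L^p(\mathbb R^d)$, with the norm $\|u\|_{H^s_p}=\left\|\mathcal F^{-1}\left((1+|\xi|^2)^{s/2}\mathcal F u\right)\right\|_{L^p}$, where $\mathcal F u(\xi)=\int e^{-i\xi\cdot x}u(x)\,dx$. For a function $g$ on $\mathbb R^d$ that does not define an element of $H^s_p$ put $\|g\|_{H^s_p}=\infty$.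 Let $s\ge0$, $2\le p<\infty$, and let $f:\mathbb R^d\times E\to\mathbb C$ be Borel measurable with $$\int_E\|f(\cdot,x')\|_{H^s_p}^p\,dx'<\infty.$$ Then the symmetric $\alpha$-stable random field with kernel $f$, that is, the random series $$U(x)=(C_\alpha|E|)^{1/\alpha}\sum_{k=1}^\infty\rho_k\Gamma_k^{-1/\alpha}f(x,V_k),\qquad x\in\mathbb R^d,$$ is an $H^s_p$-valued random variable. Precisely: there is a Borel measurable map $U:\Omega\to H^s_p$ such that, almost surely, the partial sums of the series belong to $H^s_p$ and converge to $U$ in the norm of $H^s_p$, and $U$ is given by a function to which the partial sums converge at almost every $x\in\mathbb R^d$. -/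

import Mathlib

open MeasureTheory ProbabilityTheory Filter Topology
open scoped ENNReal SchwartzMap

noncomputable section

/-! ### Bessel potential spaces `H^s_p(ℝ^d)` -/

/-- The symbol `(1 + |η|^2)^(s/2)` of `(1 - Δ)^(s/2)`, where `η` is the frequency variable of
`∫ exp(-i η · x) u(x) dx`. Mathlib's Fourier transform is `∫ exp(-2πi ξ · x) u(x) dx`, so that
`η = 2πξ`. -/
def besselSymbol (d : ℕ) (s : ℝ) (ξ : EuclideanSpace ℝ (Fin d)) : ℂ :=
  ((1 + (2 * Real.pi * ‖ξ‖) ^ 2) ^ (s / 2) : ℝ)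

/-- The symbol has temperate growth, so that it is an admissible Fourier multiplier. -/
theorem besselSymbol_hasTemperateGrowth (d : ℕ) (s : ℝ) :
    (besselSymbol d s).HasTemperateGrowth := by
  have h1 := Function.hasTemperateGrowth_one_add_norm_sq_rpow (EuclideanSpace ℝ (Fin d)) (s / 2)
  have h2 : (fun ξ : EuclideanSpace ℝ (Fin d) => (2 * Real.pi) • ξ).HasTemperateGrowth := by
    fun_prop
  have h3 := (h1.comp h2)
  have h4 : (fun ξ : EuclideanSpace ℝ (Fin d) =>
      (((1 + ‖(2 * Real.pi) • ξ‖ ^ 2) ^ (s / 2) : ℝ) : ℂ)).HasTemperateGrowth := by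
    have := h3
    simp only [Function.comp_def] at this
    fun_prop
  convert h4 using 1
  funext ξ
  simp only [besselSymbol, norm_smul, Real.norm_eq_abs, abs_of_pos Real.two_pi_pos]

/-- The operator `u ↦ 𝓕⁻¹ ((1 + |η|^2)^(s/2) 𝓕 u)` on tempered distributions. -/
def besselOp (d : ℕ) (s : ℝ) :
    𝓢'(EuclideanSpace ℝ (Fin d), ℂ) →L[ℂ] 𝓢'(EuclideanSpace ℝ (Fin d), ℂ) :=
  TemperedDistribution.fourierMultiplierCLM ℂ (besselSymbol d s)

theorem besselOp_neg_besselOp (d : ℕ) (s : ℝ) (u : 𝓢'(EuclideanSpace ℝ (Fin d), ℂ)) :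
    besselOp d (-s) (besselOp d s u) = u := by
  have h : besselSymbol d s * besselSymbol d (-s) = fun _ => 1 := by
    funext ξ
    have hpos : (0 : ℝ) < 1 + (2 * Real.pi * ‖ξ‖) ^ 2 := by positivity
    simp only [Pi.mul_apply, besselSymbol]
    rw [← Complex.ofReal_mul, ← Real.rpow_add hpos]
    simp [neg_div]
  rw [besselOp, besselOp, TemperedDistribution.fourierMultiplierCLM_fourierMultiplierCLM_apply
    (besselSymbol_hasTemperateGrowth d s) (besselSymbol_hasTemperateGrowth d (-s)), h]
  simp

/-- The tempered distributions `u` on `ℝ^d` with `𝓕⁻¹ ((1 + |η|^2)^(s/2) 𝓕 u) ∈ L^p(ℝ^d)`. -/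
def sobolevSubmodule (d : ℕ) (s : ℝ) (p : ℝ≥0∞) [Fact (1 ≤ p)] :
    Submodule ℂ 𝓢'(EuclideanSpace ℝ (Fin d), ℂ) :=
  (LinearMap.range (Lp.toTemperedDistributionCLM ℂ
    (volume : Measure (EuclideanSpace ℝ (Fin d))) p).toLinearMap).comap (besselOp d s).toLinearMap

/-- The space `H^s_p(ℝ^d)` as a type of its own; it carries the topology of its norm and not the one
of the tempered distributions. -/
def SobolevSpace (d : ℕ) (s : ℝ) (p : ℝ≥0∞) [Fact (1 ≤ p)] : Type :=
  sobolevSubmodule d s p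

namespace SobolevSpace

variable {d : ℕ} {s : ℝ} {p : ℝ≥0∞} [Fact (1 ≤ p)]

instance : AddCommGroup (SobolevSpace d s p) :=
  inferInstanceAs (AddCommGroup (sobolevSubmodule d s p))

instance : Module ℂ (SobolevSpace d s p) :=
  inferInstanceAs (Module ℂ (sobolevSubmodule d s p))

/-- The inclusion of `H^s_p(ℝ^d)` in the tempered distributions. -/
def toDistribution : SobolevSpace d s p →ₗ[ℂ] 𝓢'(EuclideanSpace ℝ (Fin d), ℂ) :=
  (sobolevSubmodule d s p).subtype

/-- The linear map from `H^s_p(ℝ^d)` to `L^p(ℝ^d)` that sends `u` to the function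
`𝓕⁻¹ ((1 + |η|^2)^(s/2) 𝓕 u)`. -/
def toLp : SobolevSpace d s p →ₗ[ℂ] Lp ℂ p (volume : Measure (EuclideanSpace ℝ (Fin d))) :=
  (LinearEquiv.ofInjective (Lp.toTemperedDistributionCLM ℂ
    (volume : Measure (EuclideanSpace ℝ (Fin d))) p).toLinearMap
    (LinearMap.ker_eq_bot.1 Lp.ker_toTemperedDistributionCLM_eq_bot)).symm.toLinearMap ∘ₗ
  ((besselOp d s).toLinearMap ∘ₗ toDistribution).codRestrict _ fun u => u.2

/-- The defining property of `toLp`. -/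
theorem toLp_spec (u : SobolevSpace d s p) :
    Lp.toTemperedDistribution (toLp u) = besselOp d s (toDistribution u) :=
  congrArg Subtype.val (LinearEquiv.apply_symm_apply (LinearEquiv.ofInjective
    (Lp.toTemperedDistributionCLM ℂ
      (volume : Measure (EuclideanSpace ℝ (Fin d))) p).toLinearMap
    (LinearMap.ker_eq_bot.1 Lp.ker_toTemperedDistributionCLM_eq_bot))
    (((besselOp d s).toLinearMap ∘ₗ toDistribution).codRestrict _ (fun u => u.2) u))

theorem toLp_injective : Function.Injective (toLp (d := d) (s := s) (p := p)) := by
  intro u v h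
  have h1 : besselOp d s (toDistribution u) = besselOp d s (toDistribution v) := by
    rw [← toLp_spec, ← toLp_spec, h]
  have h2 := congrArg (besselOp d (-s)) h1
  rw [besselOp_neg_besselOp, besselOp_neg_besselOp] at h2
  exact Subtype.ext h2

/-- The norm of `H^s_p(ℝ^d)` is `‖𝓕⁻¹ ((1 + |η|^2)^(s/2) 𝓕 u)‖_{L^p}`. -/
instance : NormedAddCommGroup (SobolevSpace d s p) :=
  NormedAddCommGroup.induced _ _ toLp toLp_injective

instance : NormedSpace ℂ (SobolevSpace d s p) :=
  NormedSpace.induced ℂ _ _ toLp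

/-- `H^s_p(ℝ^d)` carries its Borel σ-algebra. -/
instance : MeasurableSpace (SobolevSpace d s p) := borel _

instance : BorelSpace (SobolevSpace d s p) := ⟨rfl⟩

theorem norm_eq (u : SobolevSpace d s p) : ‖u‖ = ‖toLp u‖ := rfl

/-- The element `u` of `H^s_p(ℝ^d)` is (the tempered distribution given by) the function `g`. -/
def IsGivenBy (u : SobolevSpace d s p) (g : EuclideanSpace ℝ (Fin d) → ℂ) : Prop :=
  ∀ φ : 𝓢(EuclideanSpace ℝ (Fin d), ℂ),
    Integrable (fun x => φ x * g x) ∧ toDistribution u φ = ∫ x, φ x * g x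

end SobolevSpace

/-- The `H^s_p(ℝ^d)` norm of a function: the norm of the element of `H^s_p(ℝ^d)` that it is, and `∞`
if it is none. -/
def sobolevENorm {d : ℕ} (s : ℝ) (p : ℝ≥0∞) [Fact (1 ≤ p)]
    (g : EuclideanSpace ℝ (Fin d) → ℂ) : ℝ≥0∞ :=
  ⨅ (u : SobolevSpace d s p) (_ : u.IsGivenBy g), ‖u‖ₑ

/-! ### The LePage series -/

/-- `C_α = (∫_0^∞ x^(-α) sin x dx)⁻¹`, where the integral is improper at infinity (it does not
converge absolutely for `α ≤ 1`). -/
def stableConst (α : ℝ) : ℝ :=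
  (limUnder atTop fun R : ℝ => ∫ x in (0 : ℝ)..R, x ^ (-α) * Real.sin x)⁻¹

/-- The arrival times `Γ_{k+1} = τ_0 + ⋯ + τ_k` for the waiting times `τ`. -/
def arrivalTime {Ω : Type*} (τ : ℕ → Ω → ℝ) (k : ℕ) (ω : Ω) : ℝ :=
  ∑ j ∈ Finset.range (k + 1), τ j ω

/-- The random input of the LePage series: the waiting times `τ` of a rate one Poisson process, and,
independent of them, an i.i.d. sequence of pairs `(V k, ρ k)` in which `V k` is uniformly distributed
on `E` and `ρ k` is, given `V k`, a fair random sign. -/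
structure IsLePageInput {Ω : Type*} [MeasurableSpace Ω] (P : Measure Ω) {m : ℕ}
    (E : Set (EuclideanSpace ℝ (Fin m))) (τ : ℕ → Ω → ℝ) (V : ℕ → Ω → E) (ρ : ℕ → Ω → ℝ) :
    Prop where
  measurable_τ : ∀ k, Measurable (τ k)
  measurable_V : ∀ k, Measurable (V k)
  measurable_ρ : ∀ k, Measurable (ρ k)
  law_τ : ∀ k, P.map (τ k) = expMeasure 1
  law_V : ∀ k, pdf.IsUniform (fun ω => (V k ω : EuclideanSpace ℝ (Fin m))) E P volume
  law_ρ : ∀ k, P.map (ρ k) =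
    (2⁻¹ : ℝ≥0∞) • Measure.dirac (1 : ℝ) + (2⁻¹ : ℝ≥0∞) • Measure.dirac (-1 : ℝ)
  indep_V_ρ : ∀ k, IndepFun (V k) (ρ k) P
  indep_τ : iIndepFun τ P
  indep_pairs : iIndepFun (fun k ω => (V k ω, ρ k ω)) P
  indep_τ_pairs : IndepFun (fun ω k => τ k ω) (fun ω k => (V k ω, ρ k ω)) P

/-- The partial sums of `(C_α |E|)^(1/α) ∑_k ρ_k Γ_k^(-1/α) f(x, V_k)`. -/
def lePagePartialSum {Ω : Type*} {d m : ℕ} (α : ℝ) (E : Set (EuclideanSpace ℝ (Fin m)))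
    (τ : ℕ → Ω → ℝ) (V : ℕ → Ω → E) (ρ : ℕ → Ω → ℝ)
    (f : EuclideanSpace ℝ (Fin d) → E → ℂ) (N : ℕ) (ω : Ω) (x : EuclideanSpace ℝ (Fin d)) : ℂ :=
  (((stableConst α * volume.real E) ^ (1 / α) : ℝ) : ℂ) *
    ∑ k ∈ Finset.range N, ((ρ k ω * arrivalTime τ k ω ^ (-1 / α) : ℝ) : ℂ) * f x (V k ω)

end

/-! The map `u ↦ 𝓕⁻¹ ((1 + |η|^2)^(s/2) 𝓕 u)` is an isometry of `H^s_p` onto `L^p`, and for `2 ≤ p <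
∞` the space `L^p` is `2`-uniformly smooth (`Lp.isTwoSmooth`). In such a space the second moment of
a sum of independent symmetric vectors is at most a constant times the sum of the second moments, so
Kolmogorov's argument gives almost sure convergence whenever these are summable
(`IsTwoSmooth.ae_exists_tendsto_sum`). Freeze the arrival times: the terms of the LePage series are
then independent and symmetric, with second moments proportional to `Γ_k^(-2/α)`. Since `Γ_k` grows
linearly and `2/α > 1`, these are summable. Fubini removes the freezing.

To return to functions, `(1 - Δ)^(-s/2)` is realised as an average of translations under a
probability measure, hence as a bounded injective operator `J` on `L^p` (`exists_besselOp_neg_clm`).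
The kernel is then `J ∘ G` with `G` measurable and `p`-integrable (`exists_measurable_kernel`), and
the theorem above applies to `G`.

Norm convergence yields pointwise convergence only along a subsequence. For the full sequence, the
scalar case of the same theorem is applied at almost every fixed `x`, and the two limits agree along
the subsequence. -/

/-! ### Two-smoothness of `L^p` for `p ≥ 2` -/

/-- The parallelogram law with an inequality and a constant: `2`-uniform smoothness. -/
def IsTwoSmooth (K : ℝ) (B : Type*) [NormedAddCommGroup B] : Prop :=
  ∀ x y : B, ‖x + y‖ ^ 2 + ‖x - y‖ ^ 2 ≤ 2 * ‖x‖ ^ 2 + 2 * K * ‖y‖ ^ 2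

/-- Used for the scalar series at a fixed `x`, with `ℂ` as a real inner product space. -/
theorem isTwoSmooth_of_innerProductSpace (𝕜 B : Type*) [RCLike 𝕜] [NormedAddCommGroup B]
    [InnerProductSpace 𝕜 B] : IsTwoSmooth 1 B := fun x y => by
  have := parallelogram_law_with_norm 𝕜 x y
  nlinarith

/-- From `1 ± t ≤ exp (±t)` and `cosh u ≤ exp (u^2/2)` the left side is at most `2 exp (r^2 t^2/2)`.
Bernoulli's inequality with exponent `t^2 ≤ 1` and base `exp (r/2)` gives the rest, which is where
the constant comes from. -/
theorem one_add_rpow_add_one_sub_rpow_le {r t : ℝ} (hr : 0 ≤ r) (ht : |t| ≤ 1) :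
    (1 + t) ^ r + (1 - t) ^ r ≤ 2 * (1 + (Real.exp (r / 2) - 1) * t ^ 2) ^ r := by
  obtain ⟨h1, h2⟩ := abs_le.1 ht
  have e1 : (1 + t) ^ r ≤ Real.exp (r * t) := by
    calc (1 + t) ^ r ≤ (Real.exp t) ^ r :=
          Real.rpow_le_rpow (by linarith) (by linarith [Real.add_one_le_exp t]) hr
      _ = _ := by rw [← Real.exp_mul, mul_comm]
  have e2 : (1 - t) ^ r ≤ Real.exp (-(r * t)) := by
    calc (1 - t) ^ r ≤ (Real.exp (-t)) ^ r :=
          Real.rpow_le_rpow (by linarith) (by linarith [Real.add_one_le_exp (-t)]) hr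
      _ = _ := by rw [← Real.exp_mul]; ring_nf
  have e3 : Real.exp (r * t) + Real.exp (-(r * t)) ≤ 2 * Real.exp ((r * t) ^ 2 / 2) := by
    have := Real.cosh_le_exp_half_sq (r * t)
    rw [Real.cosh_eq] at this
    linarith
  have e4 : Real.exp ((r * t) ^ 2 / 2) ≤ (1 + (Real.exp (r / 2) - 1) * t ^ 2) ^ r := by
    have hs : (0 : ℝ) ≤ Real.exp (r / 2) - 1 := by
      linarith [Real.add_one_le_exp (r / 2)]
    have := _root_.rpow_one_add_le_one_add_mul_self (s := Real.exp (r / 2) - 1) (by linarith)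
      (sq_nonneg t) ((sq_le_one_iff_abs_le_one t).2 ht)
    calc Real.exp ((r * t) ^ 2 / 2) = ((1 + (Real.exp (r / 2) - 1)) ^ (t ^ 2)) ^ r := by
          rw [add_sub_cancel, ← Real.exp_mul, ← Real.exp_mul]; ring_nf
      _ ≤ _ := by
        refine Real.rpow_le_rpow (by positivity) ?_ hr
        linarith
  linarith

/-- A two-point inequality of Bonami type, with a constant that is not optimal. -/
theorem norm_add_rpow_add_norm_sub_rpow_le {𝕜 H : Type*} [RCLike 𝕜] [NormedAddCommGroup H]
    [InnerProductSpace 𝕜 H] {r : ℝ} (hr : 0 ≤ r) (x y : H) :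
    (‖x + y‖ ^ 2) ^ r + (‖x - y‖ ^ 2) ^ r ≤
      2 * (‖x‖ ^ 2 + (1 + 4 * (Real.exp (r / 2) - 1)) * ‖y‖ ^ 2) ^ r := by
  have hs : (0 : ℝ) ≤ Real.exp (r / 2) - 1 := by linarith [Real.add_one_le_exp (r / 2)]
  set c := Real.exp (r / 2) - 1 with hc
  have hpar := parallelogram_law_with_norm 𝕜 x y
  -- Here `D` is twice the real part of the inner product, so that `‖x ± y‖^2 = A ± D`; dividing by
  -- `A` reduces to the scalar inequality at `t = D / A`.
  set A := ‖x‖ ^ 2 + ‖y‖ ^ 2 with hA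
  set D := ‖x + y‖ ^ 2 - A with hD
  have hp : ‖x + y‖ ^ 2 = A + D := by ring
  have hm : ‖x - y‖ ^ 2 = A - D := by rw [hD, hA]; nlinarith
  have hD1 : |D| ≤ 2 * ‖x‖ * ‖y‖ := by
    rw [abs_le]
    have h1 := norm_add_le x y
    have h2 := norm_sub_le x y
    have := norm_nonneg (x + y)
    have := norm_nonneg (x - y)
    constructor
    · have : A - D ≤ (‖x‖ + ‖y‖) ^ 2 := by rw [← hm]; gcongr
      nlinarith
    · have : A + D ≤ (‖x‖ + ‖y‖) ^ 2 := by rw [← hp]; gcongr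
      nlinarith
  rw [hp, hm]
  by_cases hA0 : A = 0
  · have hx : ‖x‖ ^ 2 = 0 := by nlinarith [sq_nonneg ‖x‖, sq_nonneg ‖y‖]
    have hy : ‖y‖ ^ 2 = 0 := by nlinarith [sq_nonneg ‖x‖, sq_nonneg ‖y‖]
    have hx' : ‖x‖ = 0 := by simpa using hx
    have hD0 : D = 0 := by simpa [hx'] using hD1
    rw [hA0, hD0, hx, hy]
    simp [two_mul]
  have hApos : 0 < A := lt_of_le_of_ne (by positivity) (Ne.symm hA0)
  have ht : |D / A| ≤ 1 := by
    rw [abs_div, abs_of_pos hApos, div_le_one hApos]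
    refine hD1.trans ?_
    nlinarith [sq_nonneg (‖x‖ - ‖y‖)]
  have hkey := one_add_rpow_add_one_sub_rpow_le hr ht
  obtain ⟨t1, t2⟩ := abs_le.1 ht
  have f1 : A + D = A * (1 + D / A) := by field_simp
  have f2 : A - D = A * (1 - D / A) := by field_simp
  rw [f1, f2, Real.mul_rpow hApos.le (by linarith), Real.mul_rpow hApos.le (by linarith), ← mul_add]
  calc _ ≤ A ^ r * (2 * (1 + c * (D / A) ^ 2) ^ r) := by gcongr
    _ = 2 * (A * (1 + c * (D / A) ^ 2)) ^ r := by
      rw [Real.mul_rpow hApos.le (by positivity)]; ring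
    _ ≤ _ := by
      gcongr
      -- `D^2 / A ≤ 4 ‖x‖^2 ‖y‖^2 / A ≤ 4 ‖y‖^2`: the origin of the factor `4`.
      have h5 : A * (D / A) ^ 2 ≤ 4 * ‖y‖ ^ 2 := by
        have : A * (D / A) ^ 2 = D ^ 2 / A := by field_simp
        rw [this, div_le_iff₀ hApos]
        have : D ^ 2 ≤ (2 * ‖x‖ * ‖y‖) ^ 2 := by rw [← sq_abs]; gcongr
        nlinarith [sq_nonneg (‖y‖ ^ 2)]
      nlinarith

theorem MeasureTheory.Lp.enorm_rpow_eq_lintegral {X : Type*} [MeasurableSpace X] {ν : Measure X} {p : ℝ≥0∞}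
    (hp0 : p ≠ 0) (hp : p ≠ ∞) {F : Type*} [NormedAddCommGroup F] (f : Lp F p ν) :
    ‖f‖ₑ ^ p.toReal = ∫⁻ x, ‖f x‖ₑ ^ p.toReal ∂ν := by
  rw [Lp.enorm_def, eLpNorm_eq_lintegral_rpow_enorm_toReal hp0 hp, ← ENNReal.rpow_mul,
    one_div_mul_cancel (ENNReal.toReal_pos hp0 hp).ne', ENNReal.rpow_one]

/-- `L^p` is `2`-uniformly smooth for `2 ≤ p < ∞`. -/
theorem MeasureTheory.Lp.isTwoSmooth {𝕜 H : Type*} [RCLike 𝕜] [NormedAddCommGroup H]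
    [InnerProductSpace 𝕜 H] {X : Type*} [MeasurableSpace X] (ν : Measure X) {p : ℝ≥0∞}
    [Fact (1 ≤ p)] (hp2 : 2 ≤ p) (hp : p ≠ ∞) :
    IsTwoSmooth (1 + 4 * (Real.exp (p.toReal / 2 / 2) - 1)) (Lp H p ν) := by
  intro x y
  set r := p.toReal / 2 with hrdef
  have hr1 : 1 ≤ r := by
    have : (2 : ℝ) ≤ p.toReal := by simpa using ENNReal.toReal_mono hp hp2
    rw [hrdef]; linarith
  have hr0 : 0 < r := by linarith
  set K := 1 + 4 * (Real.exp (r / 2) - 1) with hK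
  have hK0 : 0 ≤ K := by
    have : (0 : ℝ) ≤ Real.exp (r / 2) - 1 := by linarith [Real.add_one_le_exp (r / 2)]
    rw [hK]; positivity
  have hp0 : p ≠ 0 := by intro h; simp [h] at hp2
  have hsq (a : ℝ≥0∞) : a ^ p.toReal = (a ^ 2) ^ r := by
    rw [← ENNReal.rpow_natCast, ← ENNReal.rpow_mul]; congr 1; rw [hrdef]; push_cast; ring
  have henn (u v : H) : (‖u + v‖ₑ ^ 2) ^ r + (‖u - v‖ₑ ^ 2) ^ r ≤
      2 * (‖u‖ₑ ^ 2 + ENNReal.ofReal K * ‖v‖ₑ ^ 2) ^ r := by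
    have := ENNReal.ofReal_le_ofReal (norm_add_rpow_add_norm_sub_rpow_le (𝕜 := 𝕜) hr0.le u v)
    rw [ENNReal.ofReal_add (by positivity) (by positivity), ENNReal.ofReal_mul (by positivity),
      ← ENNReal.ofReal_rpow_of_nonneg (by positivity) hr0.le,
      ← ENNReal.ofReal_rpow_of_nonneg (by positivity) hr0.le,
      ← ENNReal.ofReal_rpow_of_nonneg (by positivity) hr0.le,
      ENNReal.ofReal_add (by positivity) (by positivity), ENNReal.ofReal_mul (by positivity),
      ENNReal.ofReal_pow (by positivity), ENNReal.ofReal_pow (by positivity),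
      ENNReal.ofReal_pow (by positivity), ENNReal.ofReal_pow (by positivity)] at this
    simpa only [ofReal_norm, ENNReal.ofReal_ofNat] using this
  have hmx : AEMeasurable (fun t => ‖x t‖ₑ ^ 2) ν :=
    (Lp.stronglyMeasurable x).enorm.pow_const 2 |>.aemeasurable
  have hmy : AEMeasurable (fun t => ENNReal.ofReal K * ‖y t‖ₑ ^ 2) ν :=
    ((Lp.stronglyMeasurable y).enorm.pow_const 2).const_mul _ |>.aemeasurable
  have hmain : (‖x + y‖ₑ ^ 2) ^ r + (‖x - y‖ₑ ^ 2) ^ r ≤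
      2 * (‖x‖ₑ ^ 2 + ENNReal.ofReal K * ‖y‖ₑ ^ 2) ^ r := by
    -- Minkowski in `L^r` with `r = p/2`, applied to the squared norms; `r ≥ 1` is the condition `p
    -- ≥ 2`.
    have hmink := ENNReal.lintegral_Lp_add_le hmx hmy hr1
    have h1 : (∫⁻ t, (‖x t‖ₑ ^ 2) ^ r ∂ν) ^ (1 / r) = ‖x‖ₑ ^ 2 := by
      simp_rw [← hsq]
      rw [← Lp.enorm_rpow_eq_lintegral hp0 hp, hsq, ← ENNReal.rpow_mul,
        mul_one_div_cancel hr0.ne', ENNReal.rpow_one]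
    have h2 : (∫⁻ t, (ENNReal.ofReal K * ‖y t‖ₑ ^ 2) ^ r ∂ν) ^ (1 / r) =
        ENNReal.ofReal K * ‖y‖ₑ ^ 2 := by
      simp_rw [ENNReal.mul_rpow_of_nonneg _ _ hr0.le, ← hsq]
      rw [lintegral_const_mul' _ _ (by simp [hr0.le]), ← Lp.enorm_rpow_eq_lintegral hp0 hp, hsq,
        ← ENNReal.mul_rpow_of_nonneg _ _ hr0.le, ← ENNReal.rpow_mul,
        mul_one_div_cancel hr0.ne', ENNReal.rpow_one]
    rw [h1, h2, one_div, ENNReal.rpow_inv_le_iff hr0] at hmink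
    rw [← hsq, ← hsq, Lp.enorm_rpow_eq_lintegral hp0 hp, Lp.enorm_rpow_eq_lintegral hp0 hp,
      ← lintegral_add_left' ((Lp.stronglyMeasurable _).enorm.pow_const _).aemeasurable]
    calc _ ≤ ∫⁻ t, 2 * (‖x t‖ₑ ^ 2 + ENNReal.ofReal K * ‖y t‖ₑ ^ 2) ^ r ∂ν := by
          refine lintegral_mono_ae ?_
          filter_upwards [Lp.coeFn_add x y, Lp.coeFn_sub x y] with t ht1 ht2
          rw [ht1, ht2, hsq, hsq]
          exact henn _ _
      _ ≤ _ := by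
        rw [lintegral_const_mul' _ _ (by simp)]
        gcongr
        exact hmink
  have hreal : (‖x + y‖ ^ 2) ^ r + (‖x - y‖ ^ 2) ^ r ≤ 2 * (‖x‖ ^ 2 + K * ‖y‖ ^ 2) ^ r := by
    rw [← ENNReal.ofReal_le_ofReal_iff (by positivity)]
    rw [ENNReal.ofReal_add (by positivity) (by positivity), ENNReal.ofReal_mul (by positivity),
      ← ENNReal.ofReal_rpow_of_nonneg (by positivity) hr0.le,
      ← ENNReal.ofReal_rpow_of_nonneg (by positivity) hr0.le,
      ← ENNReal.ofReal_rpow_of_nonneg (by positivity) hr0.le,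
      ENNReal.ofReal_add (by positivity) (by positivity), ENNReal.ofReal_mul (by positivity),
      ENNReal.ofReal_pow (by positivity), ENNReal.ofReal_pow (by positivity),
      ENNReal.ofReal_pow (by positivity), ENNReal.ofReal_pow (by positivity)]
    simpa only [ofReal_norm, ENNReal.ofReal_ofNat] using hmain
  -- Convexity of `t ↦ t^r` bounds the `r`-th power of the mean by the mean of the `r`-th powers;
  -- taking `r`-th roots then leaves the two-smoothness inequality.
  have hpm := @(convexOn_rpow hr1).2 (‖x + y‖ ^ 2)
    (Set.mem_Ici.2 (by positivity)) (‖x - y‖ ^ 2) (Set.mem_Ici.2 (by positivity))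
    (1 / 2) (1 / 2) (by norm_num) (by norm_num) (by norm_num)
  simp only [smul_eq_mul] at hpm
  have hle : (1 / 2 * ‖x + y‖ ^ 2 + 1 / 2 * ‖x - y‖ ^ 2) ^ r ≤ (‖x‖ ^ 2 + K * ‖y‖ ^ 2) ^ r := by
    linarith
  have := (Real.rpow_le_rpow_iff (by positivity) (by positivity) hr0).1 hle
  linarith

/-! ### Almost sure convergence of series of independent symmetric vectors -/

section RandomSeries

variable {Ω : Type*} [MeasurableSpace Ω] {P : Measure Ω} [IsProbabilityMeasure P]
  {B : Type*} [NormedAddCommGroup B]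
  [MeasurableSpace B] [BorelSpace B] [SecondCountableTopology B] {K : ℝ}

/-- By independence and symmetry `(S, -Y)` has the law of `(S, Y)`, so both terms on the left of the
two-smoothness inequality have the same mean. This replaces the orthogonality of a Hilbert space. -/
theorem IsTwoSmooth.integral_norm_add_sq_le (hB : IsTwoSmooth K B) {S Y : Ω → B}
    (hS : MemLp S 2 P) (hY : MemLp Y 2 P) (hind : IndepFun S Y P)
    (hsym : P.map (-Y) = P.map Y) :
    ∫ ω, ‖S ω + Y ω‖ ^ 2 ∂P ≤ ∫ ω, ‖S ω‖ ^ 2 ∂P + K * ∫ ω, ‖Y ω‖ ^ 2 ∂P := by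
  have hSm := hS.1.aemeasurable
  have hYm := hY.1.aemeasurable
  have hlaw : P.map (fun ω => (S ω, (-Y) ω)) = P.map (fun ω => (S ω, Y ω)) := by
    have hind' : IndepFun S (-Y) P := hind.comp measurable_id measurable_neg
    rw [hind.map_prod_eq_prod_map_map hSm hYm, hind'.map_prod_eq_prod_map_map hSm hYm.neg, hsym]
  have hmeas : AEStronglyMeasurable (fun z : B × B => ‖z.1 + z.2‖ ^ 2)
      (P.map (fun ω => (S ω, Y ω))) := by
    have : Measurable (fun z : B × B => ‖z.1 + z.2‖ ^ 2) := by fun_prop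
    exact this.aestronglyMeasurable
  have heq : ∫ ω, ‖S ω - Y ω‖ ^ 2 ∂P = ∫ ω, ‖S ω + Y ω‖ ^ 2 ∂P := by
    have h1 := integral_map (hSm.prodMk hYm) hmeas
    have h2 := integral_map (hSm.prodMk hYm.neg) (hlaw ▸ hmeas)
    rw [hlaw, h1] at h2
    simpa [sub_eq_add_neg] using h2.symm
  have hi1 : Integrable (fun ω => ‖S ω + Y ω‖ ^ 2) P := (hS.add hY).integrable_norm_pow two_ne_zero
  have hi2 : Integrable (fun ω => ‖S ω - Y ω‖ ^ 2) P := (hS.sub hY).integrable_norm_pow two_ne_zero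
  have hi3 := hS.integrable_norm_pow two_ne_zero
  have hi4 := hY.integrable_norm_pow two_ne_zero
  have := integral_mono (hi1.add hi2) ((hi3.const_mul 2).add (hi4.const_mul (2 * K)))
    (fun ω => hB (S ω) (Y ω))
  simp only [Pi.add_apply] at this
  rw [integral_add hi1 hi2, integral_add (hi3.const_mul 2) (hi4.const_mul _), integral_const_mul,
    integral_const_mul, heq] at this
  linarith

variable {Y : ℕ → Ω → B}

theorem IsTwoSmooth.integral_norm_sum_sq_le (hB : IsTwoSmooth K B) (hY : ∀ k, Measurable (Y k))
    (hind : iIndepFun Y P) (hsym : ∀ k, P.map (-Y k) = P.map (Y k)) (hL2 : ∀ k, MemLp (Y k) 2 P)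
    (n : ℕ) :
    ∫ ω, ‖∑ i ∈ Finset.range n, Y i ω‖ ^ 2 ∂P ≤
      K * ∑ i ∈ Finset.range n, ∫ ω, ‖Y i ω‖ ^ 2 ∂P := by
  induction n with
  | zero => simp
  | succ n ih =>
    have hS : MemLp (fun ω => ∑ i ∈ Finset.range n, Y i ω) 2 P := memLp_finsetSum _ fun i _ => hL2 i
    have hi : IndepFun (fun ω => ∑ i ∈ Finset.range n, Y i ω) (Y n) P := by
      simpa [Finset.sum_fn] using hind.indepFun_sum_range_succ hY n
    simp only [Finset.sum_range_succ, mul_add]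
    exact (hB.integral_norm_add_sq_le hS (hL2 n) hi (hsym n)).trans (by gcongr)

variable [NormedSpace ℝ B] [CompleteSpace B]

/-- Kolmogorov's maximal inequality. -/
theorem IsTwoSmooth.measure_exists_le_norm_sum_le (hB : IsTwoSmooth K B)
    (hY : ∀ k, Measurable (Y k)) (hind : iIndepFun Y P) (hsym : ∀ k, P.map (-Y k) = P.map (Y k))
    (hL2 : ∀ k, MemLp (Y k) 2 P) {ε : ℝ} (hε : 0 < ε) (n : ℕ) :
    P {ω | ∃ k ≤ n, ε ≤ ‖∑ i ∈ Finset.range (k + 1), Y i ω‖} ≤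
      ENNReal.ofReal (K * (∑ i ∈ Finset.range (n + 1), ∫ ω, ‖Y i ω‖ ^ 2 ∂P) / ε ^ 2) := by
  have hsm : ∀ k, StronglyMeasurable (Y k) := fun k => (hY k).stronglyMeasurable
  set 𝒢 := Filtration.natural Y hsm with h𝒢
  have hYad : StronglyAdapted 𝒢 Y := Filtration.stronglyAdapted_natural hsm
  set S : ℕ → Ω → B := fun k ω => ∑ i ∈ Finset.range (k + 1), Y i ω with hS
  have hSL2 : ∀ k, MemLp (S k) 2 P := fun k => memLp_finsetSum _ fun i _ => hL2 i
  have hSint : ∀ k, Integrable (S k) P := fun k => (hSL2 k).integrable (by norm_num)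
  have hYint : ∀ k, Integrable (Y k) P := fun k => (hL2 k).integrable (by norm_num)
  have hmean : ∀ k, ∫ ω, Y k ω ∂P = 0 := fun k => by
    have h1 : ∫ ω, (-Y k) ω ∂P = ∫ ω, Y k ω ∂P := by
      have := integral_map (hY k).neg.aemeasurable (f := fun z : B => z) (μ := P)
        aestronglyMeasurable_id
      have h2 := integral_map (hY k).aemeasurable (f := fun z : B => z) (μ := P)
        aestronglyMeasurable_id
      rw [← this, ← h2, hsym k]
    simp only [Pi.neg_apply, integral_neg] at h1
    have h2 : (2 : ℝ) • ∫ ω, Y k ω ∂P = 0 := by rw [two_smul]; nth_rw 1 [← h1]; simp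
    exact (smul_eq_zero.1 h2).resolve_left two_ne_zero
  have hSad : StronglyAdapted 𝒢 S := fun k => by
    refine Finset.stronglyMeasurable_fun_sum _ fun i hi => ?_
    exact (hYad i).mono (𝒢.mono (Finset.mem_range_succ_iff.1 hi))
  have hSmart : ∀ k, P[S (k + 1) | 𝒢 k] =ᵐ[P] S k := fun k => by
    have h1 : S (k + 1) = S k + Y (k + 1) := by
      funext ω; simp only [hS, Pi.add_apply]; rw [Finset.sum_range_succ]
    rw [h1]
    filter_upwards [condExp_add (hSint k) (hYint (k + 1)) (𝒢 k),
      hind.condExp_natural_ae_eq_of_lt hsm k.lt_succ_self] with ω h2 h3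
    rw [h2, Pi.add_apply, h3, hmean, add_zero,
      condExp_of_stronglyMeasurable (𝒢.le k) (hSad k) (hSint k)]
  have hint2 : ∀ k, Integrable (fun ω => ‖S k ω‖ ^ 2) P := fun k =>
    (hSL2 k).integrable_norm_pow two_ne_zero
  -- Conditional Jensen for the convex function `‖·‖^2`; Doob's maximal inequality then reduces the
  -- claim to the second moment of the last partial sum.
  have hsub : Submartingale (fun k ω => ‖S k ω‖ ^ 2) 𝒢 P := by
    refine submartingale_nat (fun k => (hSad k).norm.pow 2) hint2 fun k => ?_
    have hconv : ConvexOn ℝ Set.univ (fun z : B => ‖z‖ ^ 2) :=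
      convexOn_univ_norm.pow (fun _ _ => norm_nonneg _) 2
    have := hconv.map_condExp_le (𝒢.le k)
      ((continuous_norm.pow 2).lowerSemicontinuous.lowerSemicontinuousOn _)
      (Eventually.of_forall fun _ => Set.mem_univ _) isClosed_univ (hSint (k + 1)) (hint2 (k + 1))
    filter_upwards [this, hSmart k] with ω h1 h2
    rw [Function.comp_apply, h2] at h1
    exact h1
  obtain ⟨e, he⟩ : ∃ e : NNReal, (e : ℝ) = ε ^ 2 := ⟨⟨ε ^ 2, by positivity⟩, rfl⟩
  have hmax := maximal_ineq hsub (fun k ω => by positivity) (ε := e) n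
  have hset : {ω | ∃ k ≤ n, ε ≤ ‖∑ i ∈ Finset.range (k + 1), Y i ω‖} =
      {ω | (e : ℝ) ≤
        (Finset.range (n + 1)).sup' Finset.nonempty_range_add_one fun k => ‖S k ω‖ ^ 2} := by
    ext ω
    simp only [Set.mem_ofPred_eq, Finset.le_sup'_iff, Finset.mem_range_succ_iff, he]
    refine exists_congr fun k => and_congr_right fun _ => ?_
    exact (pow_le_pow_iff_left₀ hε.le (norm_nonneg _) two_ne_zero).symm
  rw [← hset] at hmax
  have hc : (e : ℝ≥0∞) = ENNReal.ofReal (ε ^ 2) := by rw [← he, ENNReal.ofReal_coe_nnreal]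
  rw [hc] at hmax
  rw [ENNReal.ofReal_div_of_pos (by positivity), ENNReal.le_div_iff_mul_le
    (Or.inl (by simp; positivity)) (Or.inl (by simp)), mul_comm]
  refine hmax.trans (ENNReal.ofReal_le_ofReal ?_)
  refine (setIntegral_le_integral (hint2 n) (Eventually.of_forall fun _ => by positivity)).trans ?_
  exact hB.integral_norm_sum_sq_le hY hind hsym hL2 (n + 1)

/-- A series of independent symmetric vectors in a `2`-uniformly smooth space converges almost
surely if the second moments are summable. -/
theorem IsTwoSmooth.ae_exists_tendsto_sum (hB : IsTwoSmooth K B)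
    (hY : ∀ k, Measurable (Y k)) (hind : iIndepFun Y P) (hsym : ∀ k, P.map (-Y k) = P.map (Y k))
    (hL2 : ∀ k, MemLp (Y k) 2 P) (hsum : Summable fun k => ∫ ω, ‖Y k ω‖ ^ 2 ∂P) :
    ∀ᵐ ω ∂P, ∃ l, Tendsto (fun n => ∑ i ∈ Finset.range n, Y i ω) atTop (𝓝 l) := by
  have htail : ∀ ε : ℝ, 0 < ε → ∀ᵐ ω ∂P, ∃ M, ∀ k,
      ‖∑ i ∈ Finset.range (k + 1), Y (i + M) ω‖ < ε := by
    intro ε hε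
    -- The maximal inequality for the series started at `M`, with the number of terms sent to
    -- infinity. The sign of `K` is unknown, hence `max K 0`.
    have hb : ∀ M, P {ω | ∃ k, ε ≤ ‖∑ i ∈ Finset.range (k + 1), Y (i + M) ω‖} ≤
        ENNReal.ofReal (max K 0 * (∑' i, ∫ ω, ‖Y (i + M) ω‖ ^ 2 ∂P) / ε ^ 2) := by
      intro M
      have hu : {ω | ∃ k, ε ≤ ‖∑ i ∈ Finset.range (k + 1), Y (i + M) ω‖} =
          ⋃ n, {ω | ∃ k ≤ n, ε ≤ ‖∑ i ∈ Finset.range (k + 1), Y (i + M) ω‖} := by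
        ext ω
        simp only [Set.mem_ofPred_eq, Set.mem_iUnion]
        exact ⟨fun ⟨k, hk⟩ => ⟨k, k, le_rfl, hk⟩, fun ⟨_, k, _, hk⟩ => ⟨k, hk⟩⟩
      have hmono : Monotone fun n => {ω | ∃ k ≤ n,
          ε ≤ ‖∑ i ∈ Finset.range (k + 1), Y (i + M) ω‖} :=
        fun a b hab ω ⟨k, hk, h⟩ => ⟨k, hk.trans hab, h⟩
      rw [hu, hmono.measure_iUnion]
      refine iSup_le fun n => ?_
      refine (hB.measure_exists_le_norm_sum_le (fun k => hY (k + M))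
        (hind.precomp (add_left_injective M)) (fun k => hsym (k + M)) (fun k => hL2 (k + M)) hε
        n).trans (ENNReal.ofReal_le_ofReal ?_)
      have h0 : ∀ i, 0 ≤ ∫ ω, ‖Y (i + M) ω‖ ^ 2 ∂P := fun i =>
        integral_nonneg fun _ => by positivity
      have h1 := ((summable_nat_add_iff M).2 hsum).sum_le_tsum (Finset.range (n + 1))
        (fun i _ => h0 i)
      gcongr ?_ / _
      exact mul_le_mul (le_max_left _ _) h1 (Finset.sum_nonneg fun i _ => h0 i) (le_max_right _ _)
    -- The bound at `M` is a tail of a convergent series, so it tends to `0`.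
    have hzero : P (⋂ M, {ω | ∃ k, ε ≤ ‖∑ i ∈ Finset.range (k + 1), Y (i + M) ω‖}) = 0 := by
      have hlim : Tendsto (fun M => ENNReal.ofReal
          (max K 0 * (∑' i, ∫ ω, ‖Y (i + M) ω‖ ^ 2 ∂P) / ε ^ 2)) atTop (𝓝 0) := by
        have := ENNReal.tendsto_ofReal
          (((tendsto_sum_nat_add fun k => ∫ ω, ‖Y k ω‖ ^ 2 ∂P).const_mul (max K 0)).div_const
            (ε ^ 2))
        simpa using this
      exact le_antisymm (ge_of_tendsto' hlim fun M =>
        (measure_mono (Set.iInter_subset _ M)).trans (hb M)) zero_le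
    filter_upwards [measure_eq_zero_iff_ae_notMem.1 hzero] with ω hω
    simpa using hω
  have hall : ∀ᵐ ω ∂P, ∀ j : ℕ, ∃ M, ∀ k,
      ‖∑ i ∈ Finset.range (k + 1), Y (i + M) ω‖ < 1 / ((j : ℝ) + 1) :=
    ae_all_iff.2 fun j => htail _ (by positivity)
  filter_upwards [hall] with ω hω
  refine cauchySeq_tendsto_of_complete (Metric.cauchySeq_iff'.2 fun ε hε => ?_)
  obtain ⟨j, hj⟩ := exists_nat_one_div_lt hε
  obtain ⟨M, hM⟩ := hω j
  refine ⟨M, fun n hn => ?_⟩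
  obtain ⟨k, rfl⟩ := Nat.exists_eq_add_of_le hn
  rcases k with _ | k
  · simpa using hε
  · rw [dist_eq_norm, Finset.sum_range_add, add_sub_cancel_left]
    simpa only [add_comm M] using (hM k).trans hj

end RandomSeries

/-! ### The LePage series in a two-smooth space -/

/-- The joint law is a product, so Fubini allows `X` to be frozen. With `X` the arrival data this
serves as conditioning on the Poisson process. -/
theorem ProbabilityTheory.IndepFun.ae_mem_of_ae_ae {Ω α β : Type*} [MeasurableSpace Ω]
    [MeasurableSpace α] [MeasurableSpace β] {P : Measure Ω} [IsProbabilityMeasure P]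
    {X : Ω → α} {Z : Ω → β} (hX : Measurable X) (hZ : Measurable Z) (hind : IndepFun X Z P)
    {s : Set (α × β)} (hs : MeasurableSet s)
    (h : ∀ᵐ a ∂P.map X, ∀ᵐ ω ∂P, (a, Z ω) ∈ s) : ∀ᵐ ω ∂P, (X ω, Z ω) ∈ s := by
  have : IsProbabilityMeasure (P.map Z) := Measure.isProbabilityMeasure_map hZ.aemeasurable
  have h1 : ∀ᵐ z ∂(P.map X).prod (P.map Z), z ∈ s := by
    rw [Measure.ae_prod_mem_iff_ae_ae_mem hs]
    filter_upwards [h] with a ha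
    exact (ae_map_iff hZ.aemeasurable (measurable_prodMk_left hs)).2 ha
  rw [← hind.map_prod_eq_prod_map_map hX.aemeasurable hZ.aemeasurable] at h1
  exact (ae_map_iff (hX.prodMk hZ).aemeasurable hs).1 h1

namespace IsLePageInput

variable {Ω : Type*} [MeasurableSpace Ω] {P : Measure Ω} {m : ℕ}
  {E : Set (EuclideanSpace ℝ (Fin m))} {τ : ℕ → Ω → ℝ} {V : ℕ → Ω → E} {ρ : ℕ → Ω → ℝ}

theorem ae_pos_τ (h : IsLePageInput P E τ V ρ) (k : ℕ) : ∀ᵐ ω ∂P, 0 < τ k ω := by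
  have h1 : ∀ᵐ t ∂P.map (τ k), 0 < t := by
    rw [h.law_τ k, ae_iff]
    simp only [not_lt]
    rw [show {a : ℝ | a ≤ 0} = Set.Iic 0 from rfl, expMeasure, gammaMeasure,
      withDensity_apply _ measurableSet_Iic, ← setLIntegral_congr Iio_ae_eq_Iic]
    exact lintegral_gammaPDF_of_nonpos le_rfl
  exact ae_of_ae_map (h.measurable_τ k).aemeasurable h1

theorem map_V (h : IsLePageInput P E τ V ρ) (hE : MeasurableSet E) (k : ℕ) :
    P.map (V k) = (volume E)⁻¹ • volume.comap (Subtype.val : E → EuclideanSpace ℝ (Fin m)) := by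
  have hemb := MeasurableEmbedding.subtype_coe hE
  have h1 := h.law_V k
  rw [pdf.IsUniform, ProbabilityTheory.cond] at h1
  have h2 : (P.map (V k)).map Subtype.val = (volume E)⁻¹ • volume.restrict E := by
    rw [Measure.map_map measurable_subtype_coe (h.measurable_V k)]; exact h1
  rw [← hemb.comap_map (P.map (V k)), h2]
  ext s hs
  rw [Measure.smul_apply, hemb.comap_apply, hemb.comap_apply, Measure.smul_apply,
    Measure.restrict_apply (hemb.measurableSet_image.2 hs), Set.inter_eq_left.2]
  rintro _ ⟨x, _, rfl⟩
  exact x.2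

theorem ae_of_ae_comap (h : IsLePageInput P E τ V ρ) (hE : MeasurableSet E) {Q : E → Prop}
    (hQ : ∀ᵐ v ∂volume.comap (Subtype.val : E → EuclideanSpace ℝ (Fin m)), Q v) (k : ℕ) :
    ∀ᵐ ω ∂P, Q (V k ω) := by
  refine ae_of_ae_map (h.measurable_V k).aemeasurable ?_
  rw [h.map_V hE k]
  exact Measure.ae_smul_measure hQ _

theorem ae_abs_ρ (h : IsLePageInput P E τ V ρ) (k : ℕ) : ∀ᵐ ω ∂P, |ρ k ω| = 1 := by
  have h1 : ∀ᵐ t ∂P.map (ρ k), |t| = 1 := by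
    rw [h.law_ρ k, ae_add_measure_iff]
    constructor <;> refine Measure.ae_smul_measure ?_ _ <;>
      rw [ae_dirac_iff (measurableSet_eq_fun (by fun_prop) (by fun_prop))] <;> simp
  exact ae_of_ae_map (h.measurable_ρ k).aemeasurable h1

variable [IsProbabilityMeasure P]

/-- The arrival times grow at least linearly. -/
theorem ae_exists_linear_le_arrivalTime (h : IsLePageInput P E τ V ρ) :
    ∀ᵐ ω ∂P, ∃ c : ℝ, 0 < c ∧ ∀ᶠ k : ℕ in atTop, c * ((k : ℝ) + 1) ≤ arrivalTime τ k ω := by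
  -- Truncation to `[0, 1]` makes integrability trivial for the strong law, keeps the mean positive,
  -- and only lowers the sums.
  set X : ℕ → Ω → ℝ := fun k ω => max 0 (min (τ k ω) 1) with hX
  have hmeas : ∀ k, Measurable (X k) := fun k =>
    measurable_const.max ((h.measurable_τ k).min measurable_const)
  have hφ : Measurable fun t : ℝ => max 0 (min t 1) :=
    measurable_const.max (measurable_id.min measurable_const)
  have hint : Integrable (X 0) P := by
    refine Integrable.of_bound (hmeas 0).aestronglyMeasurable 1 (Eventually.of_forall fun ω => ?_)
    rw [Real.norm_eq_abs, abs_of_nonneg (le_max_left _ _)]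
    exact max_le zero_le_one (min_le_right _ _)
  have hslln := strong_law_ae_real X hint
    (fun i j hij => (h.indep_τ.indepFun hij).comp hφ hφ)
    (fun i => IdentDistrib.comp (f := τ i) (g := τ 0) ⟨(h.measurable_τ i).aemeasurable,
      (h.measurable_τ 0).aemeasurable, by rw [h.law_τ i, h.law_τ 0]⟩ hφ)
  have hpos : 0 < ∫ ω, X 0 ω ∂P := by
    refine (integral_pos_iff_support_of_nonneg (f := X 0) (fun ω => le_max_left _ _) hint).2 ?_
    refine pos_iff_ne_zero.2 fun h0 => ?_
    obtain ⟨ω, h1, h2⟩ := ((measure_eq_zero_iff_ae_notMem.1 h0).and (h.ae_pos_τ 0)).exists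
    have : 0 < X 0 ω := lt_max_of_lt_right (lt_min h2 one_pos)
    exact h1 this.ne'
  filter_upwards [hslln, ae_all_iff.2 h.ae_pos_τ] with ω hω hτ
  refine ⟨(∫ ω, X 0 ω ∂P) / 2, half_pos hpos, ?_⟩
  -- Shift by one: `arrivalTime τ k` has `k + 1` summands.
  have hev := (hω.comp (tendsto_add_atTop_nat 1)).eventually
    (lt_mem_nhds (half_lt_self hpos))
  filter_upwards [hev] with k hk
  rw [Function.comp_apply, lt_div_iff₀ (by positivity)] at hk
  refine (by exact_mod_cast hk.le : _ ≤ _).trans ?_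
  refine Finset.sum_le_sum fun i _ => ?_
  exact max_le (hτ i).le (min_le_left _ _)

theorem ae_summable_arrivalTime (h : IsLePageInput P E τ V ρ) {α : ℝ} (hα0 : 0 < α) (hα2 : α < 2) :
    ∀ᵐ ω ∂P, Summable fun k => (arrivalTime τ k ω ^ (-1 / α)) ^ 2 := by
  filter_upwards [h.ae_exists_linear_le_arrivalTime] with ω ⟨c, hc, hk⟩
  have hs : Summable fun k : ℕ => (c * ((k : ℝ) + 1)) ^ (-(2 / α)) := by
    have h1 : Summable fun k : ℕ => ((k : ℝ)) ^ (-(2 / α)) :=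
      Real.summable_nat_rpow.2 (by rw [neg_lt_neg_iff, lt_div_iff₀ hα0]; linarith)
    have h2 := ((summable_nat_add_iff 1).2 h1).mul_left (c ^ (-(2 / α)))
    refine h2.congr fun k => ?_
    rw [Real.mul_rpow hc.le (by positivity)]
    push_cast; rfl
  refine summable_of_isBigO_nat hs (Asymptotics.IsBigO.of_bound 1 ?_)
  filter_upwards [hk] with k hk
  have hpos : 0 < c * ((k : ℝ) + 1) := by positivity
  have hpos' := hpos.trans_le hk
  rw [one_mul, Real.norm_of_nonneg (by positivity), Real.norm_of_nonneg (by positivity),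
    ← Real.rpow_natCast, ← Real.rpow_mul hpos'.le,
    show -1 / α * ((2 : ℕ) : ℝ) = -(2 / α) by push_cast; ring]
  exact Real.rpow_le_rpow_of_nonpos hpos hk (by rw [neg_nonpos]; positivity)

theorem map_neg_ρ (h : IsLePageInput P E τ V ρ) (k : ℕ) :
    P.map (fun ω => (V k ω, -ρ k ω)) = P.map (fun ω => (V k ω, ρ k ω)) := by
  have hV := (h.measurable_V k).aemeasurable (μ := P)
  have hρ := (h.measurable_ρ k).aemeasurable (μ := P)
  have hind' : IndepFun (V k) (fun ω => -ρ k ω) P :=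
    (h.indep_V_ρ k).comp measurable_id measurable_neg
  have hlaw : P.map (fun ω => -ρ k ω) = P.map (ρ k) := by
    have : P.map (fun ω => -ρ k ω) = (P.map (ρ k)).map (fun t => -t) := by
      rw [Measure.map_map measurable_neg (h.measurable_ρ k)]; rfl
    rw [this, h.law_ρ k, Measure.map_add _ _ measurable_neg, Measure.map_smul, Measure.map_smul,
      Measure.map_dirac' measurable_neg, Measure.map_dirac' measurable_neg, neg_neg, add_comm]
  have hρ' : AEMeasurable (fun ω => -ρ k ω) P := hρ.neg
  rw [(h.indep_V_ρ k).map_prod_eq_prod_map_map hV hρ,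
    hind'.map_prod_eq_prod_map_map hV hρ', hlaw]

variable {B : Type*} [NormedAddCommGroup B] [MeasurableSpace B] [BorelSpace B]
  [SecondCountableTopology B] [NormedSpace ℝ B] [CompleteSpace B] {K : ℝ}

/-- The series with frozen coefficients `a k`. Since `|ρ k| = 1`, the second moment of the `k`-th
term is `a k ^ 2` times a constant independent of `k`; the symmetry comes from `map_neg_ρ`. -/
theorem ae_exists_tendsto_sum_of_summable (h : IsLePageInput P E τ V ρ) (hE : MeasurableSet E)
    (hE0 : volume E ≠ 0) (hB : IsTwoSmooth K B) {g : E → B} (hg : Measurable g)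
    (hg2 : MemLp g 2 (volume.comap (Subtype.val : E → EuclideanSpace ℝ (Fin m))))
    {a : ℕ → ℝ} (ha : Summable fun k => a k ^ 2) :
    ∀ᵐ ω ∂P, ∃ l, Tendsto (fun N => ∑ k ∈ Finset.range N, (ρ k ω * a k) • g (V k ω))
      atTop (𝓝 l) := by
  have hφ : ∀ k, Measurable fun z : E × ℝ => (z.2 * a k) • g z.1 := fun k =>
    (measurable_snd.mul_const _).smul (hg.comp measurable_fst)
  have hpair : ∀ k, Measurable fun ω => (V k ω, ρ k ω) := fun k =>
    (h.measurable_V k).prodMk (h.measurable_ρ k)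
  have hgV : ∀ k, MemLp (fun ω => g (V k ω)) 2 P := fun k => by
    refine MemLp.comp_of_map ?_ (h.measurable_V k).aemeasurable
    rw [h.map_V hE k]
    exact hg2.smul_measure (ENNReal.inv_ne_top.2 hE0)
  have hbound : ∀ k, ∀ᵐ ω ∂P, ‖(ρ k ω * a k) • g (V k ω)‖ = |a k| * ‖g (V k ω)‖ := fun k => by
    filter_upwards [h.ae_abs_ρ k] with ω hω
    rw [norm_smul, Real.norm_eq_abs, abs_mul, hω, one_mul]
  have hlaw : ∀ k, ∫ ω, ‖g (V k ω)‖ ^ 2 ∂P = ∫ v, ‖g v‖ ^ 2 ∂((volume E)⁻¹ •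
      volume.comap (Subtype.val : E → EuclideanSpace ℝ (Fin m))) := fun k => by
    rw [← h.map_V hE k, integral_map (h.measurable_V k).aemeasurable
      (hg.norm.pow_const 2).aestronglyMeasurable]
  refine hB.ae_exists_tendsto_sum (Y := fun k ω => (ρ k ω * a k) • g (V k ω))
    (fun k => (hφ k).comp (hpair k)) (h.indep_pairs.comp _ hφ) (fun k => ?_) (fun k => ?_) ?_
  · have h1 := congrArg (Measure.map fun z : E × ℝ => (z.2 * a k) • g z.1) (h.map_neg_ρ k)
    have hn : Measurable fun ω => (V k ω, -ρ k ω) := (h.measurable_V k).prodMk (h.measurable_ρ k).neg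
    rw [Measure.map_map (hφ k) (hpair k), Measure.map_map (hφ k) hn] at h1
    rw [← show _ = P.map (fun ω => (ρ k ω * a k) • g (V k ω)) from h1]
    congr 1
    funext ω
    simp
  · refine (hgV k).of_le_mul (c := |a k|) ((hφ k).comp (hpair k)).aestronglyMeasurable ?_
    filter_upwards [hbound k] with ω hω using hω.le
  · refine (ha.mul_right (∫ v, ‖g v‖ ^ 2 ∂((volume E)⁻¹ •
      volume.comap (Subtype.val : E → EuclideanSpace ℝ (Fin m))))).congr fun k => ?_
    rw [← hlaw k, ← integral_const_mul]
    refine integral_congr_ae ?_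
    filter_upwards [hbound k] with ω hω
    rw [hω, mul_pow, sq_abs]

/-- The LePage series of a square integrable kernel with values in a `2`-uniformly smooth space
converges almost surely. -/
theorem ae_exists_tendsto_sum (h : IsLePageInput P E τ V ρ) (hE : MeasurableSet E)
    (hE0 : volume E ≠ 0) {α : ℝ} (hα0 : 0 < α) (hα2 : α < 2)
    (hB : IsTwoSmooth K B) {g : E → B} (hg : Measurable g)
    (hg2 : MemLp g 2 (volume.comap (Subtype.val : E → EuclideanSpace ℝ (Fin m)))) :
    ∀ᵐ ω ∂P, ∃ l, Tendsto (fun N => ∑ k ∈ Finset.range N,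
      (ρ k ω * arrivalTime τ k ω ^ (-1 / α)) • g (V k ω)) atTop (𝓝 l) := by
  have hX : Measurable fun ω k => τ k ω := measurable_pi_lambda _ h.measurable_τ
  have hZ : Measurable fun ω k => (V k ω, ρ k ω) := measurable_pi_lambda _ fun k =>
    (h.measurable_V k).prodMk (h.measurable_ρ k)
  have hT : ∀ k, Measurable fun t : ℕ → ℝ => arrivalTime (fun j t => t j) k t := fun k => by
    unfold arrivalTime; fun_prop
  -- Convergence, as a property of both the waiting times and the pairs, must be a measurable event
  -- for Fubini.
  have hs : MeasurableSet {z : (ℕ → ℝ) × (ℕ → E × ℝ) | ∃ l, Tendsto (fun N =>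
      ∑ k ∈ Finset.range N, ((z.2 k).2 * arrivalTime (fun j (t : ℕ → ℝ) => t j) k z.1 ^ (-1 / α)) •
        g (z.2 k).1) atTop (𝓝 l)} := by
    refine measurableSet_exists_tendsto fun N => ?_
    refine (Finset.measurable_fun_sum _ fun k _ => Measurable.smul ?_ ?_)
    · exact (by fun_prop : Measurable fun z : (ℕ → ℝ) × (ℕ → E × ℝ) => (z.2 k).2).mul
        (((hT k).comp measurable_fst).pow_const _)
    · exact hg.comp (by fun_prop)
  refine h.indep_τ_pairs.ae_mem_of_ae_ae hX hZ hs ?_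
  have hsum : ∀ᵐ t ∂P.map (fun ω k => τ k ω), Summable fun k =>
      (arrivalTime (fun j (t : ℕ → ℝ) => t j) k t ^ (-1 / α)) ^ 2 := by
    refine (ae_map_iff hX.aemeasurable ?_).2 (h.ae_summable_arrivalTime hα0 hα2)
    have hm : ∀ k, Measurable fun t : ℕ → ℝ =>
        (arrivalTime (fun j (t : ℕ → ℝ) => t j) k t ^ (-1 / α)) ^ 2 := fun k =>
      ((hT k).pow_const _).pow_const 2
    simp_rw [Summable, hasSum_iff_tendsto_nat_of_nonneg (fun _ => sq_nonneg _)]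
    exact measurableSet_exists_tendsto fun N => Finset.measurable_fun_sum _ fun k _ => hm k
  filter_upwards [hsum] with t ht
  exact h.ae_exists_tendsto_sum_of_summable hE hE0 hB hg hg2 ht

end IsLePageInput

/-! ### Bessel potentials as averages of translations -/

theorem integral_exp_neg_mul_gammaMeasure {a b : ℝ} (ha : 0 < a) (hb : 0 ≤ b) :
    ∫ r, Real.exp (-(b * r)) ∂gammaMeasure a 1 = (1 + b) ^ (-a) := by
  have hG := Real.Gamma_pos_of_pos ha
  have h1 : ∫ r, Real.exp (-(b * r)) ∂gammaMeasure a 1 =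
      ∫ r, gammaPDFReal a 1 r * Real.exp (-(b * r)) := by
    have hm : Measurable (gammaPDF a 1) := (measurable_gammaPDFReal a 1).ennreal_ofReal
    rw [gammaMeasure, integral_withDensity_eq_integral_toReal_smul hm
      (Eventually.of_forall fun _ => ENNReal.ofReal_lt_top)]
    refine integral_congr_ae (Eventually.of_forall fun r => ?_)
    simp only [gammaPDF, smul_eq_mul]
    rw [ENNReal.toReal_ofReal (gammaPDFReal_nonneg ha one_pos r)]
  have h2 : (fun r => gammaPDFReal a 1 r * Real.exp (-(b * r))) = (Set.Ici 0).indicator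
      fun r => (Real.Gamma a)⁻¹ * (r ^ (a - 1) * Real.exp (-((1 + b) * r))) := by
    funext r
    by_cases hr : 0 ≤ r
    · rw [Set.indicator_of_mem (Set.mem_Ici.2 hr), gammaPDFReal, if_pos hr, Real.one_rpow,
        mul_assoc, mul_assoc, ← Real.exp_add]
      ring_nf
    · rw [Set.indicator_of_notMem (by simpa using hr), gammaPDFReal, if_neg hr, zero_mul]
  rw [h1, h2, integral_indicator measurableSet_Ici, integral_Ici_eq_integral_Ioi,
    integral_const_mul, Real.integral_rpow_mul_exp_neg_mul_Ioi ha (by linarith), mul_comm,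
    mul_assoc, mul_inv_cancel₀ hG.ne', mul_one, one_div, Real.inv_rpow (by linarith),
    Real.rpow_neg (by linarith)]

/-- A Gaussian mixture: for `r` gamma distributed with shape `s/2` and an independent standard
Gaussian `z`, the vector `√(2r) z` has characteristic function `E exp (-r ‖t‖^2) = (1 +
‖t‖^2)^(-s/2)`. For `s = 0` the gamma law degenerates and the Dirac mass at `0` takes its place. -/
theorem exists_charFun_eq_besselSymbol (d : ℕ) {s : ℝ} (hs : 0 ≤ s) :
    ∃ μ : Measure (EuclideanSpace ℝ (Fin d)), IsProbabilityMeasure μ ∧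
      ∀ ξ, charFun μ ((-2 * Real.pi) • ξ) = besselSymbol d (-s) ξ := by
  rcases hs.eq_or_lt with rfl | hs
  · exact ⟨Measure.dirac 0, inferInstance, fun ξ => by simp [charFun_dirac, besselSymbol]⟩
  have hprob := isProbabilityMeasure_gammaMeasure (half_pos hs) one_pos
  set γ := gammaMeasure (s / 2) 1 with hγ
  have hm : Measurable fun q : ℝ × EuclideanSpace ℝ (Fin d) => √(2 * q.1) • q.2 := by fun_prop
  refine ⟨(γ.prod (stdGaussian _)).map fun q => √(2 * q.1) • q.2,
    Measure.isProbabilityMeasure_map hm.aemeasurable, fun ξ => ?_⟩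
  have hpos : ∀ᵐ r ∂γ, 0 ≤ r := by
    rw [ae_iff]
    simp only [not_le]
    rw [show {a : ℝ | a < 0} = Set.Iio 0 from rfl, hγ, gammaMeasure,
      withDensity_apply _ measurableSet_Iio]
    exact lintegral_gammaPDF_of_nonpos le_rfl
  set t := (-2 * Real.pi) • ξ with ht
  have hint : Integrable (fun q : ℝ × EuclideanSpace ℝ (Fin d) =>
      Complex.exp (inner ℝ (√(2 * q.1) • q.2) t * Complex.I)) (γ.prod (stdGaussian _)) := by
    refine Integrable.of_bound (by fun_prop) 1 (Eventually.of_forall fun q => ?_)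
    rw [Complex.norm_exp_ofReal_mul_I]
  rw [charFun_apply, integral_map hm.aemeasurable (by fun_prop), integral_prod _ hint]
  have h1 : ∀ᵐ r ∂γ, ∫ z, Complex.exp (inner ℝ (√(2 * r) • z) t * Complex.I)
      ∂(stdGaussian (EuclideanSpace ℝ (Fin d))) = ((Real.exp (-(‖t‖ ^ 2 * r)) : ℝ) : ℂ) := by
    filter_upwards [hpos] with r hr
    have := charFun_stdGaussian (E := EuclideanSpace ℝ (Fin d)) (√(2 * r) • t)
    rw [charFun_apply] at this
    simp only [inner_smul_left, inner_smul_right, RCLike.conj_to_real] at this ⊢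
    rw [this, Complex.ofReal_exp, norm_smul, Real.norm_eq_abs]
    congr 1
    norm_cast
    rw [mul_pow, sq_abs, Real.sq_sqrt (by positivity)]
    ring
  rw [integral_congr_ae h1, integral_complex_ofReal,
    integral_exp_neg_mul_gammaMeasure (half_pos hs) (by positivity), besselSymbol, ht, norm_smul]
  congr 2
  · rw [norm_mul]; simp [abs_of_pos Real.pi_pos]
  · ring

open FourierTransform in
-- Writing the characteristic function as an integral of exponentials turns the multiplier into an
-- average of translates, by Fubini.
theorem fourier_smulLeftCLM_fourierInv_apply {d : ℕ} {μ : Measure (EuclideanSpace ℝ (Fin d))}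
    [IsProbabilityMeasure μ] {g : EuclideanSpace ℝ (Fin d) → ℂ} (hg : g.HasTemperateGrowth)
    (hμ : ∀ ξ, charFun μ ((-2 * Real.pi) • ξ) = g ξ) (φ : 𝓢(EuclideanSpace ℝ (Fin d), ℂ))
    (x : EuclideanSpace ℝ (Fin d)) :
    𝓕 (SchwartzMap.smulLeftCLM ℂ g (𝓕⁻ φ)) x = ∫ y, φ (x + y) ∂μ := by
  set ψ : 𝓢(EuclideanSpace ℝ (Fin d), ℂ) := 𝓕⁻ φ with hψ
  have hφψ : φ = 𝓕 ψ := by rw [hψ, FourierTransform.fourier_fourierInv_eq]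
  have hF : ∀ (u : 𝓢(EuclideanSpace ℝ (Fin d), ℂ)) z, (𝓕 u) z =
      ∫ ξ, Complex.exp (((-2 * Real.pi * inner ℝ ξ z : ℝ) : ℂ) * Complex.I) * u ξ := fun u z => by
    rw [SchwartzMap.fourier_coe, Real.fourier_eq']; rfl
  have hint : Integrable (fun q : EuclideanSpace ℝ (Fin d) × EuclideanSpace ℝ (Fin d) =>
      Complex.exp (((-2 * Real.pi * inner ℝ q.1 (x + q.2) : ℝ) : ℂ) * Complex.I) * ψ q.1)
      (volume.prod μ) := by
    refine (ψ.integrable.comp_fst μ).bdd_mul (c := 1) (by fun_prop)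
      (Eventually.of_forall fun q => ?_)
    rw [Complex.norm_exp_ofReal_mul_I]
  calc 𝓕 (SchwartzMap.smulLeftCLM ℂ g ψ) x
      = ∫ ξ, ∫ y, Complex.exp (((-2 * Real.pi * inner ℝ ξ (x + y) : ℝ) : ℂ) * Complex.I) * ψ ξ
          ∂μ := by
        rw [hF]
        refine integral_congr_ae (Eventually.of_forall fun ξ => ?_)
        simp only
        rw [SchwartzMap.smulLeftCLM_apply_apply hg, smul_eq_mul, ← hμ ξ, charFun_apply,
          integral_mul_const, ← mul_assoc, ← integral_const_mul]
        congr 1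
        refine integral_congr_ae (Eventually.of_forall fun y => ?_)
        simp only
        rw [← Complex.exp_add, inner_add_right, inner_smul_right, real_inner_comm ξ y]
        push_cast
        ring_nf
    _ = ∫ y, φ (x + y) ∂μ := by
        rw [integral_integral_swap hint]
        refine integral_congr_ae (Eventually.of_forall fun y => ?_)
        simp only
        rw [hφψ, hF]

section Average

variable {d : ℕ} {μ : Measure (EuclideanSpace ℝ (Fin d))} [IsProbabilityMeasure μ]
  {h : EuclideanSpace ℝ (Fin d) → ℂ}

/-- Averages of translates do not increase the `L^p` norm. -/
theorem lintegral_lintegral_enorm_sub_rpow_le (hm : StronglyMeasurable h) {p : ℝ} (hp : 1 ≤ p) :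
    ∫⁻ x, (∫⁻ y, ‖h (x - y)‖ₑ ∂μ) ^ p ≤ ∫⁻ x, ‖h x‖ₑ ^ p := by
  have hm2 : Measurable fun q : EuclideanSpace ℝ (Fin d) × EuclideanSpace ℝ (Fin d) =>
      ‖h (q.1 - q.2)‖ₑ ^ p :=
    (hm.measurable.comp (measurable_fst.sub measurable_snd)).enorm.pow_const p
  -- Jensen for the probability measure `μ`, then Tonelli and translation invariance.
  calc ∫⁻ x, (∫⁻ y, ‖h (x - y)‖ₑ ∂μ) ^ p ≤ ∫⁻ x, ∫⁻ y, ‖h (x - y)‖ₑ ^ p ∂μ := by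
        refine lintegral_mono fun x => ?_
        have hsm : AEStronglyMeasurable (fun y => h (x - y)) μ :=
          (hm.comp_measurable (measurable_const.sub measurable_id)).aestronglyMeasurable
        have := eLpNorm_le_eLpNorm_of_exponent_le (μ := μ)
          (ENNReal.one_le_ofReal.2 hp) hsm
        rw [eLpNorm_one_eq_lintegral_enorm, eLpNorm_eq_lintegral_rpow_enorm_toReal
          (by simp; linarith) (by simp), ENNReal.toReal_ofReal (by linarith), one_div,
          ENNReal.le_rpow_inv_iff (by linarith)] at this
        exact this
    _ = ∫⁻ y, ∫⁻ x, ‖h (x - y)‖ₑ ^ p ∂volume ∂μ := lintegral_lintegral_swap hm2.aemeasurable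
    _ = ∫⁻ x, ‖h x‖ₑ ^ p := by
        simp_rw [lintegral_sub_right_eq_self fun x => ‖h x‖ₑ ^ p]
        simp

/-- Hölder between the Schwartz function and the averaged modulus of `h`; it justifies Fubini in
`integral_mul_average`. -/
theorem lintegral_lintegral_enorm_mul_lt_top (hm : StronglyMeasurable h) {p : ℝ≥0∞} (hp1 : 1 < p)
    (hp : p ≠ ∞) (hL : MemLp h p) (φ : 𝓢(EuclideanSpace ℝ (Fin d), ℂ)) :
    ∫⁻ x, ∫⁻ y, ‖φ x‖ₑ * ‖h (x - y)‖ₑ ∂μ < ∞ := by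
  have hp1' : 1 < p.toReal := by simpa using (ENNReal.toReal_lt_toReal ENNReal.one_ne_top hp).2 hp1
  have hconj : (p.toReal.conjExponent).HolderConjugate p.toReal :=
    (Real.HolderConjugate.conjExponent hp1').symm
  have hW : Measurable fun x => ∫⁻ y, ‖h (x - y)‖ₑ ∂μ :=
    Measurable.lintegral_prod_right'
      (f := fun q : EuclideanSpace ℝ (Fin d) × EuclideanSpace ℝ (Fin d) => ‖h (q.1 - q.2)‖ₑ)
      (hm.measurable.comp (measurable_fst.sub measurable_snd)).enorm
  have hc : ∀ x, ∫⁻ y, ‖φ x‖ₑ * ‖h (x - y)‖ₑ ∂μ = ‖φ x‖ₑ * ∫⁻ y, ‖h (x - y)‖ₑ ∂μ := fun x =>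
    lintegral_const_mul _ (hm.measurable.comp (measurable_const.sub measurable_id)).enorm
  simp_rw [hc]
  refine (ENNReal.lintegral_mul_le_Lp_mul_Lq volume hconj φ.continuous.measurable.enorm.aemeasurable
    hW.aemeasurable).trans_lt (ENNReal.mul_lt_top ?_ ?_)
  · have := (φ.memLp (ENNReal.ofReal p.toReal.conjExponent)
      (μ := (volume : Measure (EuclideanSpace ℝ (Fin d))))).2
    rw [eLpNorm_eq_lintegral_rpow_enorm_toReal (by simpa using hconj.pos) (by simp),
      ENNReal.toReal_ofReal hconj.nonneg] at this
    exact this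
  · refine ENNReal.rpow_lt_top_of_nonneg (by positivity) (ne_of_lt ?_)
    refine (lintegral_lintegral_enorm_sub_rpow_le hm hp1'.le).trans_lt ?_
    exact lintegral_rpow_enorm_lt_top_of_eLpNorm_lt_top (by positivity) hp hL.2

theorem memLp_average (hm : StronglyMeasurable h) {p : ℝ≥0∞} (hp1 : 1 < p)
    (hp : p ≠ ∞) (hL : MemLp h p) :
    MemLp (fun x => ∫ y, h (x - y) ∂μ) p ∧
      eLpNorm (fun x => ∫ y, h (x - y) ∂μ) p volume ≤ eLpNorm h p volume := by
  have hp0 : p ≠ 0 := (zero_lt_one.trans hp1).ne'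
  have hp1' : 1 < p.toReal := by simpa using (ENNReal.toReal_lt_toReal ENNReal.one_ne_top hp).2 hp1
  have hsm : StronglyMeasurable fun x => ∫ y, h (x - y) ∂μ :=
    StronglyMeasurable.integral_prod_right'
      (f := fun q : EuclideanSpace ℝ (Fin d) × EuclideanSpace ℝ (Fin d) => h (q.1 - q.2))
      (hm.comp_measurable (measurable_fst.sub measurable_snd))
  have hle : eLpNorm (fun x => ∫ y, h (x - y) ∂μ) p volume ≤ eLpNorm h p volume := by
    rw [eLpNorm_eq_lintegral_rpow_enorm_toReal hp0 hp, eLpNorm_eq_lintegral_rpow_enorm_toReal hp0 hp]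
    refine ENNReal.rpow_le_rpow ?_ (by positivity)
    refine le_trans (lintegral_mono fun x => ?_)
      (lintegral_lintegral_enorm_sub_rpow_le (μ := μ) hm hp1'.le)
    exact ENNReal.rpow_le_rpow (enorm_integral_le_lintegral_enorm _) (by positivity)
  exact ⟨⟨hsm.aestronglyMeasurable, hle.trans_lt hL.2⟩, hle⟩

theorem integral_mul_average (hm : StronglyMeasurable h) {p : ℝ≥0∞} (hp1 : 1 < p)
    (hp : p ≠ ∞) (hL : MemLp h p) (φ : 𝓢(EuclideanSpace ℝ (Fin d), ℂ)) :
    ∫ x, φ x * ∫ y, h (x - y) ∂μ = ∫ x, (∫ y, φ (x + y) ∂μ) * h x := by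
  have hfin := lintegral_lintegral_enorm_mul_lt_top (μ := μ) hm hp1 hp hL φ
  have hm1 : StronglyMeasurable fun q : EuclideanSpace ℝ (Fin d) × EuclideanSpace ℝ (Fin d) =>
      φ q.1 * h (q.1 - q.2) :=
    (φ.continuous.stronglyMeasurable.comp_measurable measurable_fst).mul
      (hm.comp_measurable (measurable_fst.sub measurable_snd))
  have hm2 : StronglyMeasurable fun q : EuclideanSpace ℝ (Fin d) × EuclideanSpace ℝ (Fin d) =>
      φ (q.1 + q.2) * h q.1 :=
    (φ.continuous.stronglyMeasurable.comp_measurable (measurable_fst.add measurable_snd)).mul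
      (hm.comp_measurable measurable_fst)
  have hi1 : Integrable (fun q : EuclideanSpace ℝ (Fin d) × EuclideanSpace ℝ (Fin d) =>
      φ q.1 * h (q.1 - q.2)) (volume.prod μ) := by
    refine ⟨hm1.aestronglyMeasurable, ?_⟩
    rw [HasFiniteIntegral, lintegral_prod _ hm1.enorm.aemeasurable]
    simpa only [enorm_mul] using hfin
  have hi2 : Integrable (fun q : EuclideanSpace ℝ (Fin d) × EuclideanSpace ℝ (Fin d) =>
      φ (q.1 + q.2) * h q.1) (volume.prod μ) := by
    refine ⟨hm2.aestronglyMeasurable, ?_⟩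
    have h1 := hi1.2
    rw [HasFiniteIntegral, lintegral_prod_symm _ hm1.enorm.aemeasurable] at h1
    rw [HasFiniteIntegral, lintegral_prod_symm _ hm2.enorm.aemeasurable]
    refine lt_of_eq_of_lt (lintegral_congr fun y => ?_) h1
    refine Eq.trans ?_ (lintegral_add_right_eq_self (fun x => ‖φ x * h (x - y)‖ₑ) y)
    simp
  calc ∫ x, φ x * ∫ y, h (x - y) ∂μ = ∫ x, ∫ y, φ x * h (x - y) ∂μ := by
        simp_rw [integral_const_mul]
    _ = ∫ y, ∫ x, φ x * h (x - y) ∂volume ∂μ := integral_integral_swap hi1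
    _ = ∫ y, ∫ x, φ (x + y) * h x ∂volume ∂μ := by
        refine integral_congr_ae (Eventually.of_forall fun y => ?_)
        simp only
        rw [← integral_add_right_eq_self _ y]
        simp
    _ = ∫ x, ∫ y, φ (x + y) * h x ∂μ := (integral_integral_swap hi2).symm
    _ = _ := by simp_rw [integral_mul_const]

end Average

/-! ### The embedding of `H^s_p` in `L^p` -/

theorem besselOp_besselOp_neg (d : ℕ) (s : ℝ) (u : 𝓢'(EuclideanSpace ℝ (Fin d), ℂ)) :
    besselOp d s (besselOp d (-s) u) = u := by
  simpa using besselOp_neg_besselOp d (-s) u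

theorem MeasureTheory.Lp.toTemperedDistribution_injective {d : ℕ} {p : ℝ≥0∞} [Fact (1 ≤ p)] :
    Function.Injective fun h : Lp ℂ p (volume : Measure (EuclideanSpace ℝ (Fin d))) =>
      Lp.toTemperedDistribution h :=
  LinearMap.ker_eq_bot.1 (Lp.ker_toTemperedDistributionCLM_eq_bot (F := ℂ)
    (μ := (volume : Measure (EuclideanSpace ℝ (Fin d)))) (p := p))

section Embedding

variable {d : ℕ} {s : ℝ} {p : ℝ≥0∞} [Fact (1 ≤ p)]

theorem exists_toTemperedDistribution_eq_besselOp_neg (hs : 0 ≤ s) (hp1 : 1 < p) (hp : p ≠ ∞)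
    (h : Lp ℂ p (volume : Measure (EuclideanSpace ℝ (Fin d)))) :
    ∃ w : Lp ℂ p (volume : Measure (EuclideanSpace ℝ (Fin d))),
      Lp.toTemperedDistribution w = besselOp d (-s) (Lp.toTemperedDistribution h) ∧ ‖w‖ ≤ ‖h‖ := by
  obtain ⟨μ, hμ, hchar⟩ := exists_charFun_eq_besselSymbol d hs
  obtain ⟨hw, hle⟩ := memLp_average (μ := μ) (Lp.stronglyMeasurable h) hp1 hp (Lp.memLp h)
  refine ⟨hw.toLp _, ?_, ?_⟩
  · ext φ
    rw [besselOp, TemperedDistribution.fourierMultiplierCLM_apply_apply,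
      Lp.toTemperedDistribution_apply, Lp.toTemperedDistribution_apply]
    have h1 : ∫ x, φ x • (hw.toLp _ : EuclideanSpace ℝ (Fin d) → ℂ) x =
        ∫ x, φ x * ∫ y, h (x - y) ∂μ := by
      refine integral_congr_ae ?_
      filter_upwards [hw.coeFn_toLp] with x hx
      rw [hx, smul_eq_mul]
    rw [h1, integral_mul_average (Lp.stronglyMeasurable h) hp1 hp (Lp.memLp h)]
    simp_rw [fourier_smulLeftCLM_fourierInv_apply (besselSymbol_hasTemperateGrowth d (-s)) hchar,
      smul_eq_mul]
  · rw [Lp.norm_toLp, Lp.norm_def]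
    exact ENNReal.toReal_mono (Lp.eLpNorm_ne_top h) hle

theorem exists_besselOp_neg_clm (d : ℕ) (hs : 0 ≤ s) (hp1 : 1 < p) (hp : p ≠ ∞) :
    ∃ J : Lp ℂ p (volume : Measure (EuclideanSpace ℝ (Fin d))) →L[ℂ]
        Lp ℂ p (volume : Measure (EuclideanSpace ℝ (Fin d))),
      ∀ h, Lp.toTemperedDistribution (J h) = besselOp d (-s) (Lp.toTemperedDistribution h) := by
  choose w hw hle using exists_toTemperedDistribution_eq_besselOp_neg (d := d) hs hp1 hp
  let T := Lp.toTemperedDistributionCLM ℂ (volume : Measure (EuclideanSpace ℝ (Fin d))) p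
  have hwT : ∀ h, T (w h) = besselOp d (-s) (T h) := hw
  -- The chosen `w` is linear because its image under the injective `T` is linear.
  have hinj : ∀ a b, T a = T b → a = b := fun a b hab => Lp.toTemperedDistribution_injective hab
  let L : Lp ℂ p (volume : Measure (EuclideanSpace ℝ (Fin d))) →ₗ[ℂ]
      Lp ℂ p (volume : Measure (EuclideanSpace ℝ (Fin d))) :=
    { toFun := w
      map_add' := fun a b => hinj _ _ (by simp only [map_add, hwT])
      map_smul' := fun c a => hinj _ _ (by simp only [map_smul, hwT, RingHom.id_apply]) }
  exact ⟨L.mkContinuous 1 fun h => by rw [one_mul]; exact hle h, hw⟩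

namespace SobolevSpace

theorem toDistribution_eq (u : SobolevSpace d s p) :
    toDistribution u = besselOp d (-s) (Lp.toTemperedDistribution (toLp u)) := by
  rw [toLp_spec, besselOp_neg_besselOp]

theorem toLp_surjective : Function.Surjective (toLp (d := d) (s := s) (p := p)) := fun h => by
  have hmem : besselOp d (-s) (Lp.toTemperedDistribution h) ∈ sobolevSubmodule d s p :=
    ⟨h, (besselOp_besselOp_neg d s _).symm⟩
  let u : SobolevSpace d s p := ⟨_, hmem⟩
  exact ⟨u, Lp.toTemperedDistribution_injective
    ((toLp_spec u).trans (besselOp_besselOp_neg d s _))⟩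

/-- The isometry `u ↦ 𝓕⁻¹ ((1 + |η|^2)^(s/2) 𝓕 u)` of `H^s_p` onto `L^p`. -/
noncomputable def lpEquiv : SobolevSpace d s p ≃ₗᵢ[ℂ] Lp ℂ p (volume : Measure (EuclideanSpace ℝ (Fin d))) :=
  LinearIsometryEquiv.ofSurjective ⟨toLp, fun _ => rfl⟩ toLp_surjective

theorem toLp_lpEquiv_symm (h : Lp ℂ p (volume : Measure (EuclideanSpace ℝ (Fin d)))) :
    toLp (lpEquiv (s := s).symm h) = h :=
  lpEquiv.apply_symm_apply h

theorem isGivenBy_of_ae_eq {u : SobolevSpace d s p}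
    {w : Lp ℂ p (volume : Measure (EuclideanSpace ℝ (Fin d)))}
    (hw : Lp.toTemperedDistribution w = toDistribution u) {g : EuclideanSpace ℝ (Fin d) → ℂ}
    (hg : g =ᵐ[volume] w) : u.IsGivenBy g := fun φ => by
  have hae : (fun x => φ x * g x) =ᵐ[volume] fun x => φ x * w x := by
    filter_upwards [hg] with x hx
    rw [hx]
  refine ⟨?_, ?_⟩
  · have := ENNReal.HolderConjugate.inv_one_sub_inv' (Fact.out : 1 ≤ p)
    have h1 := (Lp.memLp w).integrable_mul (φ.memLp (1 - p⁻¹)⁻¹)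
    exact (h1.congr (Eventually.of_forall fun x => mul_comm _ _)).congr hae.symm
  · rw [← hw, Lp.toTemperedDistribution_apply, integral_congr_ae hae]
    rfl

/-- Test with a bump function equal to `1` on a ball containing the compact set. -/
theorem IsGivenBy.locallyIntegrable {u : SobolevSpace d s p} {g : EuclideanSpace ℝ (Fin d) → ℂ}
    (hu : u.IsGivenBy g) : LocallyIntegrable g := by
  rw [locallyIntegrable_iff]
  intro k hk
  obtain ⟨R, hR0, hR⟩ := hk.isBounded.subset_closedBall_lt 0 0
  let b : ContDiffBump (0 : EuclideanSpace ℝ (Fin d)) := ⟨R, R + 1, hR0, by linarith⟩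
  have hg₁ : HasCompactSupport (Complex.ofRealCLM ∘ b) := b.hasCompactSupport.comp_left rfl
  have hg₂ : ContDiff ℝ (⊤ : ℕ∞) (Complex.ofRealCLM ∘ b) :=
    Complex.ofRealCLM.contDiff.comp b.contDiff
  refine ((hu (hg₁.toSchwartzMap hg₂)).1.integrableOn (s := k)).congr_fun_ae ?_
  filter_upwards [ae_restrict_mem hk.measurableSet] with x hx
  have : b x = 1 := b.one_of_mem_closedBall (hR hx)
  simp [this]

theorem IsGivenBy.ae_eq {u : SobolevSpace d s p}
    {w : Lp ℂ p (volume : Measure (EuclideanSpace ℝ (Fin d)))}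
    (hw : Lp.toTemperedDistribution w = toDistribution u) {g : EuclideanSpace ℝ (Fin d) → ℂ}
    (hu : u.IsGivenBy g) : g =ᵐ[volume] w := by
  refine ae_eq_of_integral_contDiff_smul_eq hu.locallyIntegrable
    ((Lp.memLp w).locallyIntegrable Fact.out) fun b hb hbc => ?_
  have hg₁ : HasCompactSupport (Complex.ofRealCLM ∘ b) := hbc.comp_left rfl
  have hg₂ : ContDiff ℝ (⊤ : ℕ∞) (Complex.ofRealCLM ∘ b) := Complex.ofRealCLM.contDiff.comp hb
  have h1 := (hu (hg₁.toSchwartzMap hg₂)).2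
  rw [← hw, Lp.toTemperedDistribution_apply] at h1
  simpa using h1.symm

end SobolevSpace

end Embedding

/-! ### Measurability of `L^p`-valued maps -/

theorem measurable_of_measurable_dist {α M : Type*} [MeasurableSpace α] [PseudoMetricSpace M]
    [SecondCountableTopology M] [MeasurableSpace M] [BorelSpace M] {F : α → M}
    (hF : ∀ c, Measurable fun a => dist (F a) c) : Measurable F := by
  refine measurable_of_isOpen fun U hU => ?_
  obtain ⟨D, hDc, hD⟩ := TopologicalSpace.exists_countable_dense M
  have hU' : F ⁻¹' U = ⋃ c ∈ D, ⋃ (q : ℚ) (_ : Metric.ball c q ⊆ U), {a | dist (F a) c < q} := by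
    ext a
    simp only [Set.mem_preimage, Set.mem_iUnion, Set.mem_ofPred_eq, exists_prop]
    refine ⟨fun ha => ?_, fun ⟨c, _, q, hq, h⟩ => hq h⟩
    obtain ⟨ε, hε, hball⟩ := Metric.isOpen_iff.1 hU _ ha
    obtain ⟨q, hq0, hq⟩ := exists_rat_btwn (half_pos hε)
    obtain ⟨c, hc, hcd⟩ := hD.exists_dist_lt (F a) hq0
    refine ⟨c, hc, q, fun z hz => hball ?_, hcd⟩
    rw [Metric.mem_ball] at hz ⊢
    rw [dist_comm] at hcd
    linarith [dist_triangle z c (F a)]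
  rw [hU']
  exact .biUnion hDc fun c _ => .iUnion fun q => .iUnion fun _ => hF c measurableSet_Iio

/-- By Tonelli `v ↦ ‖f(·, v) - c‖_p` is measurable for each `c`, and in a separable metric space
measurable distances to points suffice. -/
theorem exists_measurable_toLp {X E : Type*} [MeasurableSpace X] [MeasurableSpace E]
    {ν : Measure X} [SFinite ν] [MeasurableSpace.CountablyGenerated X] {p : ℝ≥0∞} [Fact (1 ≤ p)]
    (hp : p ≠ ∞) [MeasurableSpace (Lp ℂ p ν)] [BorelSpace (Lp ℂ p ν)] {f : X → E → ℂ}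
    (hf : Measurable (Function.uncurry f)) :
    MeasurableSet {v | MemLp (fun x => f x v) p ν} ∧ ∃ F : E → Lp ℂ p ν, Measurable F ∧
      ∀ v, MemLp (fun x => f x v) p ν → F v =ᵐ[ν] fun x => f x v := by
  classical
  have hp0 : p ≠ 0 := (zero_lt_one.trans_le Fact.out).ne'
  have : Fact (p ≠ ∞) := ⟨hp⟩
  have hfv : ∀ v, Measurable fun x => f x v := fun v => hf.comp (measurable_id.prodMk measurable_const)
  have hnorm : ∀ c : Lp ℂ p ν, Measurable fun v => eLpNorm (fun x => f x v - c x) p ν := fun c => by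
    simp_rw [eLpNorm_eq_lintegral_rpow_enorm_toReal hp0 hp]
    refine Measurable.pow_const (Measurable.lintegral_prod_left'
      (f := fun q : X × E => ‖f q.1 q.2 - c q.1‖ₑ ^ p.toReal) ?_) _
    exact (hf.sub ((Lp.stronglyMeasurable c).measurable.comp measurable_fst)).enorm.pow_const _
  have hA : MeasurableSet {v | MemLp (fun x => f x v) p ν} := by
    have h0 : Measurable fun v => eLpNorm (fun x => f x v) p ν := by
      simp_rw [eLpNorm_eq_lintegral_rpow_enorm_toReal hp0 hp]
      refine Measurable.pow_const (Measurable.lintegral_prod_left'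
        (f := fun q : X × E => ‖f q.1 q.2‖ₑ ^ p.toReal) ?_) _
      exact hf.enorm.pow_const _
    have : {v | MemLp (fun x => f x v) p ν} = (fun v => eLpNorm (fun x => f x v) p ν) ⁻¹' Set.Iio ∞ :=
      Set.ext fun v => ⟨fun h => h.2, fun h => ⟨(hfv v).aestronglyMeasurable, h⟩⟩
    rw [this]
    exact h0 measurableSet_Iio
  refine ⟨hA, fun v => if h : MemLp (fun x => f x v) p ν then h.toLp _ else 0, ?_, fun v hv => ?_⟩
  · refine measurable_of_measurable_dist fun c => ?_
    have : (fun v => dist (if h : MemLp (fun x => f x v) p ν then h.toLp _ else 0) c) = fun v =>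
        if MemLp (fun x => f x v) p ν then (eLpNorm (fun x => f x v - c x) p ν).toReal
          else dist 0 c := by
      funext v
      split_ifs with h
      · rw [Lp.dist_def]
        congr 1
        refine eLpNorm_congr_ae ?_
        filter_upwards [h.coeFn_toLp] with x hx
        rw [Pi.sub_apply, hx]
      · rfl
    rw [this]
    exact Measurable.ite hA (hnorm c).ennreal_toReal measurable_const
  · simp only [dif_pos hv]
    exact hv.coeFn_toLp

/-! ### The LePage series in `H^s_p` -/

/-- Let `J` be the embedding of `H^s_p ≅ L^p` in `L^p`. A kernel with finite `H^s_p` norm is, for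
almost every parameter, given by `J ∘ G` with a measurable map `G` into `L^p`. -/
theorem exists_measurable_kernel {d : ℕ} {s : ℝ} {p : ℝ≥0∞} [Fact (1 ≤ p)] (hp : p ≠ ∞)
    {J : Lp ℂ p (volume : Measure (EuclideanSpace ℝ (Fin d))) →L[ℂ]
      Lp ℂ p (volume : Measure (EuclideanSpace ℝ (Fin d)))}
    (hJ : ∀ h, Lp.toTemperedDistribution (J h) = besselOp d (-s) (Lp.toTemperedDistribution h))
    [MeasurableSpace (Lp ℂ p (volume : Measure (EuclideanSpace ℝ (Fin d))))]
    [BorelSpace (Lp ℂ p (volume : Measure (EuclideanSpace ℝ (Fin d))))]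
    {E : Type*} [MeasurableSpace E] {ν : Measure E} {f : EuclideanSpace ℝ (Fin d) → E → ℂ}
    (hf : Measurable (Function.uncurry f))
    (hfint : ∫⁻ v, sobolevENorm s p (fun x => f x v) ^ p.toReal ∂ν < ∞) :
    ∃ G : E → Lp ℂ p (volume : Measure (EuclideanSpace ℝ (Fin d))), Measurable G ∧ MemLp G p ν ∧
      ∀ᵐ v ∂ν, (fun x => f x v) =ᵐ[volume] J (G v) := by
  classical
  have : Fact (p ≠ ∞) := ⟨hp⟩
  have hp0 : p ≠ 0 := (zero_lt_one.trans_le Fact.out).ne'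
  have hpos : 0 < p.toReal := ENNReal.toReal_pos hp0 hp
  have hinj : Function.Injective J := fun a b hab => by
    apply Lp.toTemperedDistribution_injective
    have h1 : besselOp d (-s) (Lp.toTemperedDistribution a) =
        besselOp d (-s) (Lp.toTemperedDistribution b) := by rw [← hJ, ← hJ, hab]
    simpa only [besselOp_besselOp_neg] using congrArg (besselOp d s) h1
  -- Lusin–Souslin: an injective continuous map between Polish spaces has Borel range and a
  -- measurable inverse on it.
  have hemb : MeasurableEmbedding J := J.continuous.measurableEmbedding hinj
  obtain ⟨hA, F, hFm, hF⟩ := exists_measurable_toLp (ν := (volume : Measure (EuclideanSpace ℝ (Fin d))))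
    hp hf
  set Ji := Function.extend J id fun _ => 0 with hJi
  have hJim : Measurable Ji := hemb.measurable_extend measurable_id measurable_const
  have hJiJ : ∀ h, Ji (J h) = h := fun h => hinj.extend_apply _ _ _
  set D : Set E := {v | MemLp (fun x => f x v) p volume} ∩ F ⁻¹' Set.range J with hD
  have hDm : MeasurableSet D := hA.inter (hFm hemb.measurableSet_range)
  have hGm : Measurable fun v => Ji (F v) := hJim.comp hFm
  -- A measurable minorant of the `p`-th power of `sobolevENorm`, which avoids proving that
  -- `sobolevENorm` is measurable in `v`. Being `∞` off `D`, it forces almost every `v` into `D`.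
  set N : E → ℝ≥0∞ := fun v => if v ∈ D then ‖Ji (F v)‖ₑ ^ p.toReal else ∞ with hN
  have hNm : Measurable N := Measurable.ite hDm (hGm.enorm.pow_const _) measurable_const
  have hNle : ∀ v, N v ≤ sobolevENorm s p (fun x => f x v) ^ p.toReal := fun v => by
    rw [← ENNReal.rpow_inv_le_iff hpos]
    refine le_iInf₂ fun u hu => ?_
    rw [ENNReal.rpow_inv_le_iff hpos]
    have hae : (fun x => f x v) =ᵐ[volume] J (SobolevSpace.toLp u) :=
      hu.ae_eq (by rw [hJ, SobolevSpace.toDistribution_eq])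
    have hmem : MemLp (fun x => f x v) p volume := (memLp_congr_ae hae).2 (Lp.memLp _)
    have hFv : F v = J (SobolevSpace.toLp u) := Lp.ext ((hF v hmem).trans hae)
    have hvD : v ∈ D := ⟨hmem, SobolevSpace.toLp u, hFv.symm⟩
    simp only [hN, if_pos hvD]
    rw [hFv, hJiJ]
    rfl
  have hNfin : ∫⁻ v, N v ∂ν < ∞ := (lintegral_mono hNle).trans_lt hfint
  have hDae : ∀ᵐ v ∂ν, v ∈ D := by
    filter_upwards [ae_lt_top hNm hNfin.ne] with v hv
    by_contra hvD
    simp [hN, hvD] at hv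
  refine ⟨fun v => Ji (F v), hGm, ⟨hGm.aestronglyMeasurable, ?_⟩, ?_⟩
  · rw [eLpNorm_eq_lintegral_rpow_enorm_toReal hp0 hp]
    refine ENNReal.rpow_lt_top_of_nonneg (by positivity) (ne_of_lt (lt_of_eq_of_lt ?_ hNfin))
    refine lintegral_congr_ae ?_
    filter_upwards [hDae] with v hv
    simp only [hN, if_pos hv]
  · filter_upwards [hDae] with v ⟨hv, h, hh⟩
    rw [← hh, hJiJ, hh]
    exact (hF v hv).symm

theorem ae_eq_sum_smul {X : Type*} [MeasurableSpace X] {ν : Measure X} {p : ℝ≥0∞} [Fact (1 ≤ p)]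
    {g : ℕ → X → ℂ} {h : ℕ → Lp ℂ p ν} (hgh : ∀ k, g k =ᵐ[ν] h k) (c : ℝ) (r : ℕ → ℝ) (N : ℕ) :
    (fun x => (c : ℂ) * ∑ k ∈ Finset.range N, (r k : ℂ) * g k x) =ᵐ[ν]
      (c • ∑ k ∈ Finset.range N, r k • h k : Lp ℂ p ν) := by
  have hsum : (fun x => ∑ k ∈ Finset.range N, (r k : ℂ) * g k x) =ᵐ[ν]
      (∑ k ∈ Finset.range N, r k • h k : Lp ℂ p ν) := by
    induction N with
    | zero =>
      filter_upwards [Lp.coeFn_zero ℂ p ν] with x hx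
      simp only [Finset.range_zero, Finset.sum_empty]
      rw [hx]; rfl
    | succ N ih =>
      simp only [Finset.sum_range_succ]
      filter_upwards [ih, hgh N, Lp.coeFn_add (∑ k ∈ Finset.range N, r k • h k) (r N • h N),
        Lp.coeFn_smul (r N) (h N)] with x h1 h2 h3 h4
      rw [h3, Pi.add_apply, h4, Pi.smul_apply, h1, h2, Complex.real_smul]
  filter_upwards [hsum, Lp.coeFn_smul c (∑ k ∈ Finset.range N, r k • h k)] with x h1 h2
  rw [h2, Pi.smul_apply, h1, Complex.real_smul]

/-- If the kernel is in `L^p(ℝ^d × E)`, then the LePage series converges at almost every point. -/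
theorem IsLePageInput.ae_ae_exists_tendsto_lePagePartialSum
    {Ω : Type*} [MeasurableSpace Ω] {P : Measure Ω} [IsProbabilityMeasure P]
    {d m : ℕ} {α : ℝ} (hα0 : 0 < α) (hα2 : α < 2)
    {E : Set (EuclideanSpace ℝ (Fin m))} (hE : MeasurableSet E)
    (hE0 : volume E ≠ 0) (hEfin : volume E ≠ ∞)
    {τ : ℕ → Ω → ℝ} {V : ℕ → Ω → E} {ρ : ℕ → Ω → ℝ} (hinput : IsLePageInput P E τ V ρ)
    {p : ℝ≥0∞} (hp2 : 2 ≤ p) (hp : p ≠ ∞)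
    {f : EuclideanSpace ℝ (Fin d) → E → ℂ} (hf : Measurable (Function.uncurry f))
    (hfint : ∫⁻ v, ∫⁻ x, ‖f x v‖ₑ ^ p.toReal ∂volume
        ∂(volume.comap (Subtype.val : E → EuclideanSpace ℝ (Fin m))) < ∞) :
    ∀ᵐ ω ∂P, ∀ᵐ x, ∃ l, Tendsto (fun N => lePagePartialSum α E τ V ρ f N ω x) atTop (𝓝 l) := by
  set ν := volume.comap (Subtype.val : E → EuclideanSpace ℝ (Fin m)) with hν
  have hνfin : IsFiniteMeasure ν := ⟨by
    rw [hν, (MeasurableEmbedding.subtype_coe hE).comap_apply]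
    simpa using hEfin.lt_top⟩
  have hp0 : p ≠ 0 := by rintro rfl; simp at hp2
  have hfm : Measurable fun q : EuclideanSpace ℝ (Fin d) × E => ‖f q.1 q.2‖ₑ ^ p.toReal :=
    hf.enorm.pow_const _
  rw [← lintegral_lintegral_swap (f := fun x v => ‖f x v‖ₑ ^ p.toReal) hfm.aemeasurable] at hfint
  have hx : ∀ᵐ x : EuclideanSpace ℝ (Fin d), MemLp (f x) 2 ν := by
    filter_upwards [ae_lt_top hfm.lintegral_prod_right' hfint.ne] with x hx
    have hfx : Measurable (f x) := hf.comp measurable_prodMk_left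
    refine MemLp.mono_exponent (q := p) ⟨hfx.aestronglyMeasurable, ?_⟩ hp2
    rw [eLpNorm_eq_lintegral_rpow_enorm_toReal hp0 hp]
    exact ENNReal.rpow_lt_top_of_nonneg (by positivity) hx.ne
  have hmS : ∀ N, Measurable fun q : EuclideanSpace ℝ (Fin d) × Ω =>
      lePagePartialSum α E τ V ρ f N q.2 q.1 := fun N => by
    unfold lePagePartialSum
    refine measurable_const.mul (Finset.measurable_fun_sum _ fun k _ => ?_)
    have hΓ : Measurable (arrivalTime τ k) :=
      Finset.measurable_fun_sum _ fun j _ => hinput.measurable_τ j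
    refine (Complex.measurable_ofReal.comp (((hinput.measurable_ρ k).mul (hΓ.pow_const _)).comp
      measurable_snd)).mul ?_
    exact hf.comp (measurable_fst.prodMk ((hinput.measurable_V k).comp measurable_snd))
  -- Interchanging the two almost-everywhere quantifiers leaves a scalar series at fixed `x`.
  refine (Measure.ae_ae_comm (measurableSet_exists_tendsto (f := fun N
    (q : EuclideanSpace ℝ (Fin d) × Ω) => lePagePartialSum α E τ V ρ f N q.2 q.1) hmS)).1 ?_
  filter_upwards [hx] with x hx
  filter_upwards [hinput.ae_exists_tendsto_sum hE hE0 hα0 hα2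
    (isTwoSmooth_of_innerProductSpace ℝ ℂ) (hf.comp measurable_prodMk_left : Measurable (f x)) hx]
    with ω ⟨l, hl⟩
  exact ⟨_, (hl.const_mul (((stableConst α * volume.real E) ^ (1 / α) : ℝ) : ℂ)).congr fun N => by
    simp only [lePagePartialSum, Complex.real_smul]; rfl⟩

theorem mainTheorem6
    {Ω : Type*} [MeasurableSpace Ω] (P : Measure Ω) [IsProbabilityMeasure P]
    {d m : ℕ} (α : ℝ) (hα0 : 0 < α) (hα2 : α < 2)
    (E : Set (EuclideanSpace ℝ (Fin m))) (hE : MeasurableSet E)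
    (hE0 : volume E ≠ 0) (hEfin : volume E ≠ ∞)
    (τ : ℕ → Ω → ℝ) (V : ℕ → Ω → E) (ρ : ℕ → Ω → ℝ) (hinput : IsLePageInput P E τ V ρ)
    (s : ℝ) (hs : 0 ≤ s) (p : ℝ≥0∞) [Fact (1 ≤ p)] (hp2 : 2 ≤ p) (hp : p ≠ ∞)
    (f : EuclideanSpace ℝ (Fin d) → E → ℂ) (hf : Measurable (Function.uncurry f))
    (hfint :
      ∫⁻ x', sobolevENorm s p (fun x => f x x') ^ p.toReal
        ∂(volume.comap (Subtype.val : E → EuclideanSpace ℝ (Fin m))) < ∞) :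
    ∃ U : Ω → SobolevSpace d s p, Measurable U ∧
      (∀ᵐ ω ∂P, ∃ S : ℕ → SobolevSpace d s p,
        (∀ N, (S N).IsGivenBy (lePagePartialSum α E τ V ρ f N ω)) ∧
          Tendsto S atTop (𝓝 (U ω))) ∧
      (∀ᵐ ω ∂P, ∃ u : EuclideanSpace ℝ (Fin d) → ℂ, (U ω).IsGivenBy u ∧
        ∀ᵐ x, Tendsto (fun N => lePagePartialSum α E τ V ρ f N ω x) atTop (𝓝 (u x))) := by
  have : Fact (p ≠ ∞) := ⟨hp⟩
  have hp0 : p ≠ 0 := (zero_lt_one.trans_le Fact.out).ne'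
  have hpos : 0 < p.toReal := ENNReal.toReal_pos hp0 hp
  have hp1 : 1 < p := lt_of_lt_of_le (by norm_num) hp2
  borelize ↥(Lp ℂ p (volume : Measure (EuclideanSpace ℝ (Fin d))))
  set ν := volume.comap (Subtype.val : E → EuclideanSpace ℝ (Fin m)) with hν
  have hνfin : IsFiniteMeasure ν := ⟨by
    rw [hν, (MeasurableEmbedding.subtype_coe hE).comap_apply]
    simpa using hEfin.lt_top⟩
  obtain ⟨J, hJ⟩ := exists_besselOp_neg_clm d hs hp1 hp
  obtain ⟨G, hGm, hGp, hG⟩ := exists_measurable_kernel hp hJ hf hfint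
  have hdist : ∀ u : SobolevSpace d s p,
      Lp.toTemperedDistribution (J (SobolevSpace.toLp u)) = SobolevSpace.toDistribution u :=
    fun u => by rw [hJ, SobolevSpace.toDistribution_eq]
  have hconv := hinput.ae_exists_tendsto_sum hE hE0 hα0 hα2 (Lp.isTwoSmooth (𝕜 := ℂ) _ hp2 hp) hGm
    (hGp.mono_exponent hp2)
  have hΓ : ∀ k, Measurable (arrivalTime τ k) := fun k =>
    Finset.measurable_fun_sum _ fun j _ => hinput.measurable_τ j
  obtain ⟨U', hU'm, hU'⟩ := measurable_limit_of_tendsto_metrizable_ae (fun N =>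
    (Finset.measurable_fun_sum (Finset.range N) fun k _ => ((hinput.measurable_ρ k).mul
      ((hΓ k).pow_const (-1 / α))).smul (hGm.comp (hinput.measurable_V k))).aemeasurable) hconv
  -- Only that `c` is a fixed real number matters below.
  set c : ℝ := (stableConst α * volume.real E) ^ (1 / α) with hc
  have hker : ∀ᵐ ω ∂P, ∀ k, (fun x => f x (V k ω)) =ᵐ[volume] J (G (V k ω)) :=
    ae_all_iff.2 fun k => hinput.ae_of_ae_comap hE hG k
  have hpartial : ∀ᵐ ω ∂P, ∀ N, lePagePartialSum α E τ V ρ f N ω =ᵐ[volume]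
      J (c • ∑ k ∈ Finset.range N, (ρ k ω * arrivalTime τ k ω ^ (-1 / α)) • G (V k ω)) := by
    filter_upwards [hker] with ω hω N
    have hsm : ∀ (r : ℝ) h, J (r • h) = r • J h := fun r h => J.map_smul_of_tower r h
    simp only [hsm, map_sum]
    exact ae_eq_sum_smul hω c (fun k => ρ k ω * arrivalTime τ k ω ^ (-1 / α)) N
  -- Boundedness of `J` on `L^p` carries the integrability of `G` over to `f`.
  have hfL : ∫⁻ v, ∫⁻ x, ‖f x v‖ₑ ^ p.toReal ∂volume ∂ν < ∞ := by
    have h1 : ∀ᵐ v ∂ν, ∫⁻ x, ‖f x v‖ₑ ^ p.toReal ∂volume ≤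
        ‖J‖ₑ ^ p.toReal * ‖G v‖ₑ ^ p.toReal := by
      filter_upwards [hG] with v hv
      rw [← ENNReal.mul_rpow_of_nonneg _ _ hpos.le]
      refine le_trans (le_of_eq ?_) (ENNReal.rpow_le_rpow (J.le_opENorm (G v)) hpos.le)
      rw [Lp.enorm_rpow_eq_lintegral hp0 hp]
      refine lintegral_congr_ae ?_
      filter_upwards [hv] with x hx
      rw [hx]
    refine (lintegral_mono_ae h1).trans_lt ?_
    rw [lintegral_const_mul _ (hGm.enorm.pow_const _)]
    exact ENNReal.mul_lt_top (ENNReal.rpow_lt_top_of_nonneg hpos.le enorm_ne_top)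
      (lintegral_rpow_enorm_lt_top_of_eLpNorm_lt_top hp0 hp hGp.2)
  have hpoint := hinput.ae_ae_exists_tendsto_lePagePartialSum hα0 hα2 hE hE0 hEfin hp2 hp hf hfL
  refine ⟨fun ω => SobolevSpace.lpEquiv.symm (c • U' ω),
    SobolevSpace.lpEquiv.symm.continuous.measurable.comp (hU'm.const_smul c), ?_, ?_⟩
  · filter_upwards [hU', hpartial] with ω hω hpω
    refine ⟨fun N => SobolevSpace.lpEquiv.symm
      (c • ∑ k ∈ Finset.range N, (ρ k ω * arrivalTime τ k ω ^ (-1 / α)) • G (V k ω)),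
      fun N => ?_, (SobolevSpace.lpEquiv.symm.continuous.tendsto _).comp (hω.const_smul c)⟩
    refine SobolevSpace.isGivenBy_of_ae_eq (hdist _) ?_
    rw [SobolevSpace.toLp_lpEquiv_symm]
    exact hpω N
  · filter_upwards [hU', hpartial, hpoint] with ω hω hpω hxω
    refine ⟨J (c • U' ω), SobolevSpace.isGivenBy_of_ae_eq (hdist _) ?_, ?_⟩
    · rw [SobolevSpace.toLp_lpEquiv_symm]
    · have hJlim := (J.continuous.tendsto _).comp (hω.const_smul c)
      -- Almost everywhere convergence along a subsequence identifies the pointwise limit `l` of the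
      -- full sequence with `J (c • U' ω)`.
      obtain ⟨ns, hns, hsub⟩ := (tendstoInMeasure_of_tendsto_Lp hJlim).exists_seq_tendsto_ae
      filter_upwards [hxω, hsub, ae_all_iff.2 hpω] with x ⟨l, hl⟩ hx hpx
      have h1 := (hl.comp hns.tendsto_atTop).congr fun i => hpx (ns i)
      rwa [tendsto_nhds_unique h1 hx] at hl
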